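/- **Theorem.** Let $n\in\{1,2,4,8\}$ (so that $n+2\in\{3,4,6,10\}$). *Setting.* A normed division algebra is a nonzero finite-dimensional, possibly nonassociative, unital real algebra $\mathbb K$ with a Euclidean norm such that $|ab|=|a||b|$; let $(\cdot,\cdot)$ be the inner product, $\mathrm{Re}(a)=(a,1)$ and $a^*=2\,\mathrm{Re}(a)1-a$. There is a normed division algebra of dimension $n$; let $\mathbb K$ be any such algebra. Let $V=\mathfrak h_2(\mathbb K)$ be the space of hermitian $2\times2$ matrices over $\mathbb K$, with the Minkowski metric $g$ of signature $(n+1,1)$ given by $g(A,A)=-\det A$, and let $S_+=\mathbb K^2$. Put $\tilde A=A-(\mathrm{tr}\,A)1$ and, for $\psi,\phi\in S_+$, $\psi\cdot\phi=\widetilde{\psi\phi^\dagger+\phi\psi^\dagger}\in V$. The Lorentz algebra $\mathfrak{so}(n+1,1)=\mathfrak{so}(V,g)$ acts on $S_+$ by the spin representation, in which the endomorphism $v\mapsto g(B,v)A-g(A,v)B$ acts as $\psi\mapsto\frac14\bigl(\tilde A(B\psi)-\tilde B(A\psi)\bigr)$. The Poincaré superalgebra is $$\mathfrak{siso}(n+1,1)=\mathfrak{so}(n+1,1)\ltimes(V\oplus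 S_+),$$ with even part $\mathfrak{so}(n+1,1)\oplus V$, odd part $S_+$, and bracket $$[(T,A,\psi),(T',A',\psi')]=([T,T'],\;TA'-T'A+\psi\cdot\psi',\;T\psi'-T'\psi).$$ Let $\alpha$ be the super-skew-symmetric trilinear form on $\mathfrak{siso}(n+1,1)$ with $\alpha(\psi,\phi,A)=g(\psi\cdot\phi,A)$ for $\psi,\phi\in S_+$, $A\in V$, which vanishes on all other types of triples (in particular when an argument lies in $\mathfrak{so}(n+1,1)$). *Claim.* $\dim V=n+2$, $g(\psi\cdot\phi,A)=\mathrm{Re}(\psi^\dagger(A\phi))$ for all $\psi,\phi\in S_+$ and $A\in V$, $\mathfrak{siso}(n+1,1)$ is a Lie superalgebra, and $\alpha$ is an even Chevalley–Eilenberg 3-cocycle on it with values in the trivial representation $\mathbb R$ which is not a coboundary. Extending $\mathfrak{siso}(n+1,1)$ by $\alpha$ gives a Lie 2-superalgebra (an $L_\infty$-superalgebra whose nonzero terms have degree $0$ or $1$), the superstring Lie 2-superalgebra $$\mathfrak{superstring}(n+1,1):\qquad \mathfrak{siso}(n+1,1)\xleftarrow{\;d=0\;}\mathbb R ,$$ with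 $\mathfrak{siso}(n+1,1)$ in degree $0$, the even line $\mathbb R$ in degree $1$, $l_1=d=0$, $l_2$ the bracket of $\mathfrak{siso}(n+1,1)$ (with $\mathbb R$ acted on trivially), $l_3=\alpha$ and $l_k=0$ for $k\ge4$. It sits in a short exact sequence of Lie 2-superalgebras $$0\to b\mathbb R\to\mathfrak{superstring}(n+1,1)\to\mathfrak{siso}(n+1,1)\to0,$$ where $b\mathbb R$ is the abelian Lie 2-superalgebra with $\mathbb R$ in degree $1$ and $\mathfrak{siso}(n+1,1)$ is placed in degree $0$. It is not exact. Here a Lie 2-superalgebra is called exact if $d=0$ and $l_3$, as a 3-cocycle on the Lie superalgebra of degree-$0$ elements with values in its representation $\rho(x)f=l_2(x,f)$ on the degree-$1$ elements, is a coboundary. -/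

import Mathlib

/-! ## Signs -/

/-- The sign `(-1)^p` of a parity `p`. -/
noncomputable def paritySign (p : ZMod 2) : ℝ := if p = 0 then 1 else -1

/-- The Koszul sign `ε(σ; x)`, defined by
`x₁ ⋯ xₙ = ε(σ; x) x_{σ(1)} ⋯ x_{σ(n)}` in the free graded-commutative algebra, for elements `xᵢ`
of grade `p i`: every inversion of `σ` contributes the sign of the transposition. -/
noncomputable def koszulSign {n : ℕ} (σ : Equiv.Perm (Fin n)) (p : Fin n → ZMod 2) : ℝ :=
  ∏ i, ∏ j, if i < j ∧ σ j < σ i then paritySign (p (σ i) * p (σ j)) else 1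

/-- The sign `χ(σ; x) = sgn(σ) ε(σ; x)`. -/
noncomputable def chiSign {n : ℕ} (σ : Equiv.Perm (Fin n)) (p : Fin n → ZMod 2) : ℝ :=
  ((Equiv.Perm.sign σ : ℤ) : ℝ) * koszulSign σ p

/-- The sign of moving the `i`-th of a list of elements of parities `p` to the front. -/
noncomputable def frontSign {n : ℕ} (p : Fin n → ZMod 2) (i : Fin n) : ℝ :=
  paritySign (p i * ∑ k ∈ Finset.Iio i, p k)

/-! ## Lie superalgebras and their cohomology -/

section Super

variable {E F : Type*} [AddCommGroup E] [Module ℝ E] [AddCommGroup F] [Module ℝ F]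

/-- A real super vector space `E = E₀ ⊕ E₁` with an even bilinear bracket which is
super-skew-symmetric and satisfies the super Jacobi identity. -/
structure IsLieSuperalgebra (𝒜 : ZMod 2 → Submodule ℝ E) (br : E →ₗ[ℝ] E →ₗ[ℝ] E) : Prop where
  isInternal : DirectSum.IsInternal 𝒜
  bracket_mem : ∀ {p q : ZMod 2} {x y : E}, x ∈ 𝒜 p → y ∈ 𝒜 q → br x y ∈ 𝒜 (p + q)
  skew : ∀ {p q : ZMod 2} {x y : E}, x ∈ 𝒜 p → y ∈ 𝒜 q →
    br x y = -(paritySign (p * q) • br y x)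
  jacobi : ∀ {p q : ZMod 2} {x y : E}, x ∈ 𝒜 p → y ∈ 𝒜 q → ∀ z : E,
    br x (br y z) = br (br x y) z + paritySign (p * q) • br y (br x z)

/-- `ω` is an `n`-cochain of parity `q` on the super vector space `(E, 𝒜)` with values in the super
vector space `(F, ℬ)`: a super-skew-symmetric `n`-linear map which preserves parity if `q = 0` and
reverses it if `q = 1`. -/
structure IsCochain {n : ℕ} (𝒜 : ZMod 2 → Submodule ℝ E) (ℬ : ZMod 2 → Submodule ℝ F)
    (q : ZMod 2) (ω : MultilinearMap ℝ (fun _ : Fin n => E) F) : Prop where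
  skew : ∀ (σ : Equiv.Perm (Fin n)) (p : Fin n → ZMod 2) (X : Fin n → E),
    (∀ i, X i ∈ 𝒜 (p i)) → ω (fun i => X (σ i)) = chiSign σ p • ω X
  parity : ∀ (p : Fin n → ZMod 2) (X : Fin n → E),
    (∀ i, X i ∈ 𝒜 (p i)) → ω X ∈ ℬ ((∑ i, p i) + q)

/-- The increasing enumeration of the indices different from `i` and `j`, where `i < j`. -/
def skipTwo {m : ℕ} (i j : Fin (m + 2)) (k : Fin m) : Fin (m + 2) :=
  if (k : ℕ) < i then ⟨k, by omega⟩
  else if (k : ℕ) + 1 < j then ⟨k + 1, by omega⟩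
  else ⟨k + 2, by omega⟩

/-- The Chevalley–Eilenberg coboundary `dω(X₁, …, Xₙ₊₁)` of an `n`-cochain `ω` of parity `q`, where
`n = m + 1`, evaluated at homogeneous elements `Xᵢ` of parity `p i`. Here `br` is the bracket and
`ρ` the action on the coefficients. Indices start at `0`. -/
noncomputable def ceDifferential {m : ℕ} (br : E → E → E) (ρ : E → F → F) (q : ZMod 2)
    (ω : (Fin (m + 1) → E) → F) (p : Fin (m + 2) → ZMod 2) (X : Fin (m + 2) → E) : F :=
  ∑ i : Fin (m + 2), ((-1) ^ (i : ℕ) * paritySign (p i * q) * frontSign p i) •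
      ρ (X i) (ω (fun k => X (i.succAbove k)))
  + ∑ i : Fin (m + 2), ∑ j ∈ Finset.Ioi i,
      ((-1) ^ ((i : ℕ) + (j : ℕ)) * paritySign (p i * p j) * frontSign p i * frontSign p j) •
        ω (Fin.cons (br (X i) (X j)) (fun k => X (skipTwo i j k)))

/-- The real line as a purely even super vector space. -/
def evenLine (p : ZMod 2) : Submodule ℝ ℝ := if p = 0 then ⊤ else ⊥

/-- `ω` is an even `(m+1)`-cocycle with values in the trivial representation `ℝ`. -/
def IsEvenCocycle {m : ℕ} (𝒜 : ZMod 2 → Submodule ℝ E) (br : E →ₗ[ℝ] E →ₗ[ℝ] E)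
    (ω : MultilinearMap ℝ (fun _ : Fin (m + 1) => E) ℝ) : Prop :=
  IsCochain 𝒜 evenLine 0 ω ∧
  ∀ (p : Fin (m + 2) → ZMod 2) (X : Fin (m + 2) → E), (∀ i, X i ∈ 𝒜 (p i)) →
    ceDifferential (fun x y => br x y) (fun _ _ => (0 : ℝ)) 0 ω p X = 0

/-- `ω` is an `(m+2)`-coboundary with values in the trivial representation `ℝ`: it is `dθ` for some
`(m+1)`-cochain `θ = θ₀ + θ₁`, where `θ₀` is even and `θ₁` is odd. -/
def IsCoboundary {m : ℕ} (𝒜 : ZMod 2 → Submodule ℝ E) (br : E →ₗ[ℝ] E →ₗ[ℝ] E)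
    (ω : MultilinearMap ℝ (fun _ : Fin (m + 2) => E) ℝ) : Prop :=
  ∃ θ₀ θ₁ : MultilinearMap ℝ (fun _ : Fin (m + 1) => E) ℝ,
    IsCochain 𝒜 evenLine 0 θ₀ ∧ IsCochain 𝒜 evenLine 1 θ₁ ∧
    ∀ (p : Fin (m + 2) → ZMod 2) (X : Fin (m + 2) → E), (∀ i, X i ∈ 𝒜 (p i)) →
      ω X = ceDifferential (fun x y => br x y) (fun _ _ => (0 : ℝ)) 0 θ₀ p X
        + ceDifferential (fun x y => br x y) (fun _ _ => (0 : ℝ)) 1 θ₁ p X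

end Super

/-! ## `L_∞`-superalgebras -/

/-- `σ` is an `(i, n - i)`-unshuffle: it is increasing on the first `i` indices and on the others. -/
def IsUnshuffle {n : ℕ} (i : ℕ) (σ : Equiv.Perm (Fin n)) : Prop :=
  ∀ a b : Fin n, a < b → ((b : ℕ) < i ∨ i ≤ (a : ℕ)) → σ a < σ b

/-- The data of an `L_∞`-superalgebra on the total space `E`: the subspaces of given degree (in `ℤ`)
and parity (in `ZMod 2`), and the `k`-ary brackets `l k`. -/
structure LInfinityData (E : Type*) [AddCommGroup E] [Module ℝ E] where
  grading : ℤ × ZMod 2 → Submodule ℝ E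
  l : (k : ℕ) → MultilinearMap ℝ (fun _ : Fin k => E) E

/-- The overall grade: degree plus parity. -/
def overallGrade (g : ℤ × ZMod 2) : ZMod 2 := (g.1 : ZMod 2) + g.2

namespace LInfinityData

variable {E : Type*} [AddCommGroup E] [Module ℝ E]

open Classical in
/-- The left-hand side of the generalized Jacobi identity in `n` arguments `xᵢ` of degree and parity
`g i`: the sum over `i + j = n + 1` with `i, j ≥ 1` and over `(i, n - i)`-unshuffles `σ` of
`χ(σ) (-1)^{i(j-1)} l_j(l_i(x_{σ(1)}, …, x_{σ(i)}), x_{σ(i+1)}, …, x_{σ(n)})`.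
The summation index `a` is `i - 1`. -/
noncomputable def jacobiator (L : LInfinityData E) {n : ℕ} (g : Fin n → ℤ × ZMod 2)
    (x : Fin n → E) : E :=
  ∑ a : Fin n, ∑ σ : Equiv.Perm (Fin n) with IsUnshuffle ((a : ℕ) + 1) σ,
    (chiSign σ (fun i => overallGrade (g i)) * (-1) ^ (((a : ℕ) + 1) * (n - ((a : ℕ) + 1)))) •
      L.l (n - ((a : ℕ) + 1) + 1)
        (Fin.cons
          (L.l ((a : ℕ) + 1) (fun b => x (σ ⟨b, by omega⟩)))
          (fun c => x (σ ⟨(a : ℕ) + 1 + c, by omega⟩)))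

/-- The laws of an `L_∞`-superalgebra. Degrees are non-negative, `l k` is defined for `k ≥ 1`
(so `l 0` is set to `0`), has degree `k - 2`, preserves parity, is graded antisymmetric, and the
generalized Jacobi identities hold. -/
structure IsLInfinitySuperalgebra (L : LInfinityData E) : Prop where
  isInternal : DirectSum.IsInternal L.grading
  nonneg : ∀ (d : ℤ) (p : ZMod 2), d < 0 → L.grading (d, p) = ⊥
  l_zero : L.l 0 = 0
  degree : ∀ (k : ℕ) (g : Fin k → ℤ × ZMod 2) (x : Fin k → E), (∀ i, x i ∈ L.grading (g i)) →
    L.l k x ∈ L.grading ((∑ i, (g i).1) + (k : ℤ) - 2, ∑ i, (g i).2)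
  skew : ∀ (k : ℕ) (σ : Equiv.Perm (Fin k)) (g : Fin k → ℤ × ZMod 2) (x : Fin k → E),
    (∀ i, x i ∈ L.grading (g i)) →
      L.l k (fun i => x (σ i)) = chiSign σ (fun i => overallGrade (g i)) • L.l k x
  jacobi : ∀ (n : ℕ) (g : Fin n → ℤ × ZMod 2) (x : Fin n → E),
    (∀ i, x i ∈ L.grading (g i)) → L.jacobiator g x = 0

/-- A Lie `n`-superalgebra: an `L_∞`-superalgebra whose nonzero terms all have degree `< n`. -/
def IsLieNSuperalgebra (n : ℕ) (L : LInfinityData E) : Prop :=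
  L.IsLInfinitySuperalgebra ∧ ∀ (d : ℤ) (p : ZMod 2), (n : ℤ) ≤ d → L.grading (d, p) = ⊥

/-- A Lie `(m+1)`-superalgebra is exact if only its terms `V₀` and `V_m` are nonzero, its
differential vanishes, and `l_{m+2}`, as a cochain on the Lie superalgebra `V₀` with values in the
representation `ρ(x)f = l₂(x, f)` of `V₀` on `V_m`, is the coboundary of a cochain `θ = θ₀ + θ₁`
(`θ₀` even, `θ₁` odd). A multilinear map on `V₀` is represented by one on the total space `E` whose
values outside `V₀` are irrelevant. -/
def IsExact (m : ℕ) (L : LInfinityData E) : Prop :=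
  (∀ (d : ℤ) (p : ZMod 2), d ≠ 0 → d ≠ m → L.grading (d, p) = ⊥) ∧
  L.l 1 = 0 ∧
  ∃ θ₀ θ₁ : MultilinearMap ℝ (fun _ : Fin (m + 1) => E) E,
    IsCochain (fun p => L.grading (0, p)) (fun p => L.grading (m, p)) 0 θ₀ ∧
    IsCochain (fun p => L.grading (0, p)) (fun p => L.grading (m, p)) 1 θ₁ ∧
    ∀ (p : Fin (m + 2) → ZMod 2) (X : Fin (m + 2) → E), (∀ i, X i ∈ L.grading (0, p i)) →
      L.l (m + 2) X
        = ceDifferential (fun x y => L.l 2 ![x, y]) (fun x f => L.l 2 ![x, f]) 0 θ₀ p X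
          + ceDifferential (fun x y => L.l 2 ![x, y]) (fun x f => L.l 2 ![x, f]) 1 θ₁ p X

/-- A (strict) homomorphism: a linear map preserving degree, parity and all brackets. -/
structure IsHom {E' : Type*} [AddCommGroup E'] [Module ℝ E'] (L : LInfinityData E)
    (L' : LInfinityData E') (f : E →ₗ[ℝ] E') : Prop where
  map_grading : ∀ (g : ℤ × ZMod 2) (x : E), x ∈ L.grading g → f x ∈ L'.grading g
  map_l : ∀ (k : ℕ) (x : Fin k → E), f (L.l k x) = L'.l k (fun i => f (x i))

/-- `0 → L' → L → L'' → 0` is a short exact sequence. -/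
structure IsShortExact {E' E'' : Type*} [AddCommGroup E'] [Module ℝ E'] [AddCommGroup E'']
    [Module ℝ E''] (L' : LInfinityData E') (L : LInfinityData E) (L'' : LInfinityData E'')
    (ι : E' →ₗ[ℝ] E) (π : E →ₗ[ℝ] E'') : Prop where
  isHom_left : IsHom L' L ι
  isHom_right : IsHom L L'' π
  injective : Function.Injective ι
  exact : Function.Exact ι π
  surjective : Function.Surjective π

end LInfinityData

section Extensions

variable {E : Type*} [AddCommGroup E] [Module ℝ E]

/-- A bilinear map as a multilinear map in two arguments. -/
def bilinToMultilinear (br : E →ₗ[ℝ] E →ₗ[ℝ] E) : MultilinearMap ℝ (fun _ : Fin 2 => E) E where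
  toFun v := br (v 0) (v 1)
  map_update_add' v i x y := by
    fin_cases i <;> simp [Function.update]
  map_update_smul' v i c x := by
    fin_cases i <;> simp [Function.update]

/-- A Lie superalgebra as an `L_∞`-superalgebra concentrated in degree `0`. -/
noncomputable def lieLInfinity (𝒜 : ZMod 2 → Submodule ℝ E) (br : E →ₗ[ℝ] E →ₗ[ℝ] E) :
    LInfinityData E where
  grading g := if g.1 = 0 then 𝒜 g.2 else ⊥
  l
    | 2 => bilinToMultilinear br
    | _ => 0

/-- The abelian `L_∞`-superalgebra `bℝ` with the even line `ℝ` in degree `1`. -/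
noncomputable def bLine : LInfinityData ℝ where
  grading g := if g.1 = 1 then evenLine g.2 else ⊥
  l _ := 0

/-- The extension of a Lie superalgebra `E` by a real-valued `3`-cochain `ω`: `E` in degree `0`, the
even line `ℝ` in degree `1`, zero differential, `l₂` the bracket of `E` (with `ℝ` acted on
trivially), `l₃ = ω`, and all other `l_k` zero. -/
noncomputable def cocycleExtension (𝒜 : ZMod 2 → Submodule ℝ E) (br : E →ₗ[ℝ] E →ₗ[ℝ] E)
    (ω : MultilinearMap ℝ (fun _ : Fin 3 => E) ℝ) : LInfinityData (E × ℝ) where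
  grading g :=
    if g.1 = 0 then (𝒜 g.2).prod ⊥ else if g.1 = 1 then (⊥ : Submodule ℝ E).prod (evenLine g.2)
    else ⊥
  l
    | 2 => (LinearMap.inl ℝ E ℝ).compMultilinearMap
        ((bilinToMultilinear br).compLinearMap fun _ => LinearMap.fst ℝ E ℝ)
    | 3 => (LinearMap.inr ℝ E ℝ).compMultilinearMap
        (ω.compLinearMap fun _ => LinearMap.fst ℝ E ℝ)
    | _ => 0

end Extensions

/-! ## Normed division algebras -/

/-- A normed division algebra: a nonzero finite-dimensional, possibly nonassociative, unital real
algebra with a Euclidean norm `|·|` such that `|ab| = |a||b|`. The norm is given by the positive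
definite quadratic form `normSq a = |a|²`. -/
class NormedDivisionAlgebra (K : Type*) extends NonAssocRing K, Module ℝ K, IsScalarTower ℝ K K,
    SMulCommClass ℝ K K, Module.Finite ℝ K, Nontrivial K where
  normSq : QuadraticForm ℝ K
  normSq_posDef : normSq.PosDef
  normSq_mul : ∀ a b : K, normSq (a * b) = normSq a * normSq b

namespace NormedDivisionAlgebra

variable {K : Type*} [NormedDivisionAlgebra K]

/-- The inner product `(a, b)` obtained by polarizing the norm. -/
noncomputable def ip : LinearMap.BilinForm ℝ K :=
  (1 / 2 : ℝ) • (normSq (K := K)).polarBilin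

/-- The real part of `a`, as a real number. -/
noncomputable def re : K →ₗ[ℝ] ℝ := (ip (K := K)).flip 1

theorem ip_apply (a b : K) :
    ip a b = (normSq (a + b) - normSq a - normSq b) / 2 := by
  simp [ip, QuadraticMap.polar]; ring

theorem re_apply (a : K) : re a = ip a 1 := rfl

theorem ip_comm (a b : K) : ip a b = ip b a := by
  rw [ip_apply, ip_apply, add_comm a b]; ring

theorem ip_self (a : K) : ip a a = normSq a := by
  rw [ip_apply, ← two_smul ℝ a, QuadraticMap.map_smul]; simp; ring

theorem normSq_add (a b : K) : normSq (a + b) = normSq a + normSq b + 2 * ip a b := by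
  rw [ip_apply]; ring

theorem ip_ext {a b : K} (h : ∀ c, ip a c = ip b c) : a = b := by
  by_contra hne
  have h1 := normSq_posDef (K := K) (a - b) (sub_ne_zero.mpr hne)
  rw [← ip_self] at h1
  have : ip (a - b) (a - b) = 0 := by
    rw [ip_comm, map_sub, ip_comm _ a, ip_comm _ b, h, sub_self]
  linarith

theorem normSq_one : normSq (1 : K) = 1 := by
  have h := normSq_mul (1 : K) 1
  have h0 := normSq_posDef (K := K) 1 one_ne_zero
  rw [mul_one] at h
  nlinarith

theorem ip_mul_left (a b c : K) : ip (a * b) (a * c) = normSq a * ip b c := by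
  have h := normSq_mul a (b + c)
  rw [mul_add, normSq_add, normSq_add, normSq_mul, normSq_mul] at h
  linarith

theorem ip_mul_mul (a b c d : K) :
    ip (a * b) (c * d) + ip (a * d) (c * b) = 2 * ip a c * ip b d := by
  have h := ip_mul_left (a + c) b d
  simp only [add_mul, map_add, LinearMap.add_apply, ip_mul_left, normSq_add] at h
  rw [ip_comm (c * b)] at h
  linarith

/-- Conjugation `a* = 2 Re(a) - a`: it fixes the line `ℝ1` and is `-1` on its orthogonal
complement. -/
noncomputable def conj (a : K) : K := (2 * re a) • (1 : K) - a

theorem ip_mul_eq_left (a b d : K) : ip (a * b) d = ip b (conj a * d) := by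
  have h := ip_mul_mul a b 1 d
  simp only [one_mul] at h
  rw [conj, sub_mul, smul_mul_assoc, one_mul, map_sub, map_smul, re_apply, smul_eq_mul,
    ip_comm b (a * d)]
  linarith

theorem ip_mul_eq_right (a b c : K) : ip (a * b) c = ip a (c * conj b) := by
  have h := ip_mul_mul a b c 1
  simp only [mul_one] at h
  rw [conj, mul_sub, mul_smul_comm, mul_one, map_sub, map_smul, re_apply, smul_eq_mul]
  linarith

theorem re_one : re (1 : K) = 1 := by rw [re_apply, ip_self, normSq_one]

theorem conj_conj (a : K) : conj (conj a) = a := by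
  simp only [conj, map_sub, map_smul, re_one, smul_eq_mul, mul_one]
  module

theorem conj_add (a b : K) : conj (a + b) = conj a + conj b := by
  simp only [conj, map_add]; module

theorem conj_smul (r : ℝ) (a : K) : conj (r • a) = r • conj a := by
  simp only [conj, map_smul, smul_eq_mul]; module

theorem conj_one : conj (1 : K) = 1 := by
  simp only [conj, re_one]; module

theorem re_mul (a b : K) : re (a * b) = ip a (conj b) := by
  rw [re_apply, ip_mul_eq_right, one_mul]

theorem conj_mul (a b : K) : conj (a * b) = conj b * conj a := by
  refine ip_ext fun c => ?_
  have h1 : ip (conj (a * b)) c = ip (conj a) (b * c) := by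
    have e1 : ip (conj (a * b)) c = ip (a * b) (conj c) := by
      have := ip_mul_eq_left (a * b) c 1
      rw [mul_one, ip_comm c] at this
      rw [← this, ip_mul_eq_right, one_mul]
    rw [e1, ip_mul_eq_left, ip_comm, ip_mul_eq_right, conj_conj]
  rw [h1, ip_mul_eq_left, conj_conj]

noncomputable instance : StarRing K where
  star := conj
  star_involutive := conj_conj
  star_mul := conj_mul
  star_add := conj_add

theorem star_eq_conj (a : K) : star a = conj a := rfl

instance : StarModule ℝ K where
  star_smul r a := by simp [star_eq_conj, conj_smul]

theorem re_star (a : K) : re (star a) = re a := by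
  simp only [star_eq_conj, conj, map_sub, map_smul, re_one, smul_eq_mul]; ring

theorem re_mul_star (a b : K) : re (a * star b) = ip a b := by
  rw [re_mul, star_eq_conj, conj_conj]

theorem eq_re_smul_of_star_eq {a : K} (h : star a = a) : a = re a • (1 : K) := by
  rw [star_eq_conj, conj, sub_eq_iff_eq_add, ← two_smul ℝ a, mul_smul] at h
  exact (smul_right_injective K (two_ne_zero (α := ℝ)) h).symm

end NormedDivisionAlgebra

/-! ## Vectors, spinors and the Poincaré superalgebra -/

namespace Superstring

open NormedDivisionAlgebra Matrix

variable (K : Type*) [NormedDivisionAlgebra K]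

/-- The space `V = 𝔥₂(K)` of hermitian `2 × 2` matrices. -/
def hermitianMatrices : Submodule ℝ (Matrix (Fin 2) (Fin 2) K) where
  carrier := {A | A.IsHermitian}
  add_mem' hA hB := hA.add hB
  zero_mem' := Matrix.isHermitian_zero
  smul_mem' r A hA := by
    change Aᴴ = A at hA
    change (r • A)ᴴ = r • A
    rw [Matrix.conjTranspose_smul, hA]; simp

/-- Vectors: the elements of `𝔥₂(K)`. -/
def Vec : Type _ := hermitianMatrices K

noncomputable instance : AddCommGroup (Vec K) :=
  inferInstanceAs (AddCommGroup (hermitianMatrices K))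

noncomputable instance : Module ℝ (Vec K) :=
  inferInstanceAs (Module ℝ (hermitianMatrices K))

instance : Module.Finite ℝ (Vec K) :=
  inferInstanceAs (Module.Finite ℝ (hermitianMatrices K))

/-- The space `S₊ = K²` of spinors. -/
abbrev Spinor : Type _ := Fin 2 → K

variable {K}

theorem Vec.ext {A B : Vec K} (h : A.1 = B.1) : A = B := Subtype.ext h

@[simp] theorem Vec.add_val (A B : Vec K) : (A + B).1 = A.1 + B.1 := rfl

@[simp] theorem Vec.smul_val (c : ℝ) (A : Vec K) : (c • A).1 = c • A.1 := rfl

theorem Vec.star_apply (A : Vec K) (i j : Fin 2) : star (A.1 i j) = A.1 j i :=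
  A.2.apply j i

/-- The Minkowski metric: the polarization of `A ↦ -det A`, where
`det A = A₁₁A₂₂ - A₁₂A₂₁ ∈ ℝ1`. -/
noncomputable def minkowski : LinearMap.BilinForm ℝ (Vec K) :=
  LinearMap.mk₂ ℝ
    (fun A B => -(1 / 2 : ℝ) * re (A.1 0 0 * B.1 1 1 + B.1 0 0 * A.1 1 1
      - A.1 0 1 * B.1 1 0 - B.1 0 1 * A.1 1 0))
    (fun A A' B => by simp [add_mul, mul_add]; ring)
    (fun c A B => by simp [smul_mul_assoc, mul_smul_comm]; ring)
    (fun A B B' => by simp [add_mul, mul_add]; ring)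
    (fun c A B => by simp [smul_mul_assoc, mul_smul_comm]; ring)

theorem minkowski_apply (A B : Vec K) :
    minkowski A B = -(1 / 2 : ℝ) * re (A.1 0 0 * B.1 1 1 + B.1 0 0 * A.1 1 1
      - A.1 0 1 * B.1 1 0 - B.1 0 1 * A.1 1 0) := rfl

/-- The vector with rows `(a, y)` and `(y*, d)`. -/
noncomputable def mkVec (a d : ℝ) (y : K) : Vec K :=
  ⟨!![a • (1 : K), y; star y, d • (1 : K)], by
    change Matrix.IsHermitian _
    ext i j; fin_cases i <;> fin_cases j <;> simp⟩

/-- The metric has signature `(n+1, 1)`. -/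
theorem minkowski_mkVec (t x : ℝ) (y : K) :
    minkowski (mkVec (t + x) (t - x) y) (mkVec (t + x) (t - x) y)
      = -t ^ 2 + x ^ 2 + normSq y := by
  rw [minkowski_apply]
  simp [mkVec, re_mul_star, ip_self, re_one]; ring

theorem minkowski_nondegenerate : (minkowski (K := K)).Nondegenerate := by
  have hsymm : ∀ A B : Vec K, minkowski A B = minkowski B A := by
    intro A B
    rw [minkowski_apply, minkowski_apply]
    congr 2; abel
  have key : ∀ A : Vec K, (∀ B, minkowski A B = 0) → A = 0 := by
    intro A hA
    have e0 := eq_re_smul_of_star_eq (A.star_apply 0 0)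
    have e1 := eq_re_smul_of_star_eq (A.star_apply 1 1)
    have h := hA (mkVec (-re (A.1 1 1)) (-re (A.1 0 0)) (A.1 0 1))
    rw [minkowski_apply, ← A.star_apply 0 1] at h
    simp only [mkVec, Matrix.of_apply, Matrix.cons_val', Matrix.cons_val_zero,
      Matrix.cons_val_one, Matrix.cons_val_fin_one, mul_smul_comm, smul_mul_assoc, mul_one,
      one_mul, map_add, map_sub, map_smul, smul_eq_mul, re_mul_star, ip_self] at h
    have hy : A.1 0 1 = 0 := by
      by_contra hne
      have := normSq_posDef (K := K) _ hne
      nlinarith [sq_nonneg (re (A.1 0 0)), sq_nonneg (re (A.1 1 1))]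
    rw [hy, map_zero] at h
    have h00 : re (A.1 0 0) = 0 := by
      nlinarith [sq_nonneg (re (A.1 0 0)), sq_nonneg (re (A.1 1 1))]
    have h11 : re (A.1 1 1) = 0 := by
      nlinarith [sq_nonneg (re (A.1 0 0)), sq_nonneg (re (A.1 1 1))]
    rw [h00, zero_smul] at e0
    rw [h11, zero_smul] at e1
    have h10 : A.1 1 0 = 0 := by rw [← A.star_apply 0 1, hy, star_zero]
    apply Subtype.ext
    ext i j
    fin_cases i <;> fin_cases j
    · exact e0
    · exact hy
    · exact h10
    · exact e1
  exact ⟨key, fun B hB => key B fun A => by rw [hsymm]; exact hB A⟩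

/-- The trace reversal `Ã = A - (tr A) 1`. -/
noncomputable def traceReversal (A : Matrix (Fin 2) (Fin 2) K) : Matrix (Fin 2) (Fin 2) K :=
  A - Matrix.diagonal fun _ => A.trace

theorem traceReversal_isHermitian {A : Matrix (Fin 2) (Fin 2) K} (hA : A.IsHermitian) :
    (traceReversal A).IsHermitian := by
  refine hA.sub ?_
  rw [Matrix.IsHermitian, Matrix.diagonal_conjTranspose]
  congr 1
  funext i
  rw [Pi.star_apply, ← Matrix.trace_conjTranspose, hA]

/-- The action of vectors `γ : V → Hom(S₊, S₋)`, `γ(A)ψ = Aψ`. -/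
noncomputable def gamma : Vec K →ₗ[ℝ] Spinor K →ₗ[ℝ] Spinor K :=
  LinearMap.mk₂ ℝ (fun A ψ => A.1 *ᵥ ψ)
    (fun _ _ _ => Matrix.add_mulVec _ _ _)
    (fun _ _ _ => Matrix.smul_mulVec _ _ _)
    (fun _ _ _ => Matrix.mulVec_add _ _ _)
    (fun _ _ _ => Matrix.mulVec_smul _ _ _)

/-- The action of vectors `γ̃ : V → Hom(S₋, S₊)`, `γ̃(A)ψ = Ãψ`. -/
noncomputable def gammaTilde : Vec K →ₗ[ℝ] Spinor K →ₗ[ℝ] Spinor K :=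
  LinearMap.mk₂ ℝ (fun A ψ => traceReversal A.1 *ᵥ ψ)
    (fun A A' ψ => by
      rw [← Matrix.add_mulVec]; congr 1
      ext i j; fin_cases i <;> fin_cases j <;> simp [traceReversal, Matrix.trace] <;> abel)
    (fun c A ψ => by
      rw [← Matrix.smul_mulVec]; congr 1
      ext i j; fin_cases i <;> fin_cases j <;> simp [traceReversal, Matrix.trace])
    (fun _ _ _ => Matrix.mulVec_add _ _ _)
    (fun _ _ _ => Matrix.mulVec_smul _ _ _)

/-- The pairing `⟨ψ, φ⟩ = Re(ψ†φ)` of `S₊` with `S₋`. -/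
noncomputable def pairing (ψ φ : Spinor K) : ℝ := re (star ψ ⬝ᵥ φ)

/-- The bracket of spinors as a function: `ψ · φ` is the trace reversal of `ψφ† + φψ†`. -/
noncomputable def spinorDotFun (ψ φ : Spinor K) : Vec K :=
  ⟨traceReversal (vecMulVec ψ (star φ) + vecMulVec φ (star ψ)),
    traceReversal_isHermitian (by ext i j; simp [vecMulVec_apply, add_comm])⟩

theorem spinorDotFun_val (ψ φ : Spinor K) :
    (spinorDotFun ψ φ).1 = traceReversal (vecMulVec ψ (star φ) + vecMulVec φ (star ψ)) := rfl

/-- The bracket of spinors `(ψ, φ) ↦ ψ · φ` as a bilinear map `S₊ × S₊ → V`. -/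
noncomputable def spinorDot : Spinor K →ₗ[ℝ] Spinor K →ₗ[ℝ] Vec K :=
  LinearMap.mk₂ ℝ spinorDotFun
    (fun ψ ψ' φ => by
      apply Vec.ext; rw [Vec.add_val]; ext i j
      fin_cases i <;> fin_cases j <;>
        simp [spinorDotFun_val, traceReversal, Matrix.trace, vecMulVec_apply, add_mul, mul_add] <;>
        abel)
    (fun c ψ φ => by
      apply Vec.ext; rw [Vec.smul_val]; ext i j
      fin_cases i <;> fin_cases j <;>
        simp [spinorDotFun_val, traceReversal, Matrix.trace, vecMulVec_apply])
    (fun ψ φ φ' => by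
      apply Vec.ext; rw [Vec.add_val]; ext i j
      fin_cases i <;> fin_cases j <;>
        simp [spinorDotFun_val, traceReversal, Matrix.trace, vecMulVec_apply, add_mul, mul_add] <;>
        abel)
    (fun c ψ φ => by
      apply Vec.ext; rw [Vec.smul_val]; ext i j
      fin_cases i <;> fin_cases j <;>
        simp [spinorDotFun_val, traceReversal, Matrix.trace, vecMulVec_apply])

variable (K) in
/-- The Lorentz algebra `𝔰𝔬(n+1, 1)`: the endomorphisms of `V` that are skew for the metric. -/
noncomputable def lorentzAlgebra : Submodule ℝ (Module.End ℝ (Vec K)) :=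
  (minkowski (K := K)).skewAdjointSubmodule

variable (K) in
/-- The underlying space of the Lorentz algebra. -/
abbrev Lorentz : Type _ := lorentzAlgebra K

/-- The commutator of two elements of the Lorentz algebra. -/
noncomputable def lorentzBracket (T T' : Lorentz K) : Lorentz K :=
  ⟨⁅T.1, T'.1⁆, LinearMap.BilinForm.isSkewAdjoint_bracket _ T.2 T'.2⟩

/-- The spin representation of the Lorentz algebra on `S₊`: the endomorphism `T` corresponds to the
element `¼ ∑ᵢ T(eᵢ) eⁱ` of the Clifford algebra of `(V, g)`, where `(eᵢ)` is a basis of `V` and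
`(eⁱ)` its dual basis with respect to `g`, and a product `AB` of two vectors acts on `S₊` as
`γ̃(A) γ(B)`. So `v ↦ g(B, v)A - g(A, v)B` acts as `¼(γ̃(A)γ(B) - γ̃(B)γ(A))`. -/
noncomputable def spinAction : Lorentz K →ₗ[ℝ] Spinor K →ₗ[ℝ] Spinor K :=
  (1 / 4 : ℝ) • ∑ i,
    (LinearMap.lcomp ℝ (Spinor K)
        (gamma (minkowski.dualBasis minkowski_nondegenerate (Module.finBasis ℝ (Vec K)) i)))
      ∘ₗ gammaTilde
      ∘ₗ LinearMap.applyₗ (Module.finBasis ℝ (Vec K) i)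
      ∘ₗ (lorentzAlgebra K).subtype

variable (K) in
/-- The underlying space of the Poincaré superalgebra `𝔰𝔦𝔰𝔬(n+1, 1) = 𝔰𝔬(n+1, 1) ⋉ (V ⊕ S₊)`. -/
abbrev Siso : Type _ := Lorentz K × Vec K × Spinor K

variable (K) in
/-- The even part is `𝔰𝔬(n+1, 1) ⊕ V`, the odd part is `S₊`. -/
noncomputable def sisoGrading (p : ZMod 2) : Submodule ℝ (Siso K) :=
  if p = 0 then (⊤ : Submodule ℝ (Lorentz K)).prod ((⊤ : Submodule ℝ (Vec K)).prod ⊥)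
  else (⊥ : Submodule ℝ (Lorentz K)).prod ((⊥ : Submodule ℝ (Vec K)).prod ⊤)

variable (K) in
/-- The bracket of the semidirect product
`[(T, A, ψ), (T', A', ψ')] = ([T, T'], T A' - T' A + ψ · ψ', T ψ' - T' ψ)`. -/
noncomputable def sisoBracket : Siso K →ₗ[ℝ] Siso K →ₗ[ℝ] Siso K :=
  LinearMap.mk₂ ℝ
    (fun x y => (lorentzBracket x.1 y.1, x.1.1 y.2.1 - y.1.1 x.2.1 + spinorDot x.2.2 y.2.2,
      spinAction x.1 y.2.2 - spinAction y.1 x.2.2))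
    (fun x x' y => by
      refine Prod.ext (Subtype.ext ?_) (Prod.ext ?_ ?_)
      · simp [lorentzBracket, Ring.lie_def, add_mul, mul_add]; abel
      · simp; abel
      · simp; abel)
    (fun c x y => by
      refine Prod.ext (Subtype.ext ?_) (Prod.ext ?_ ?_)
      · simp [lorentzBracket, Ring.lie_def, smul_sub]
      · simp [smul_add, smul_sub]
      · simp [smul_sub])
    (fun x y y' => by
      refine Prod.ext (Subtype.ext ?_) (Prod.ext ?_ ?_)
      · simp [lorentzBracket, Ring.lie_def, add_mul, mul_add]; abel
      · simp; abel
      · simp; abel)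
    (fun c x y => by
      refine Prod.ext (Subtype.ext ?_) (Prod.ext ?_ ?_)
      · simp [lorentzBracket, Ring.lie_def, smul_sub]
      · simp [smul_add, smul_sub]
      · simp [smul_sub])

variable (K) in
/-- The super-skew-symmetric trilinear form with `α(ψ, φ, A) = g(ψ · φ, A)` for spinors `ψ, φ` and
a vector `A`, which vanishes on all other kinds of triples, in particular when some argument lies
in the Lorentz algebra. -/
noncomputable def alpha : MultilinearMap ℝ (fun _ : Fin 3 => Siso K) ℝ where
  toFun x := minkowski (spinorDot (x 0).2.2 (x 1).2.2) (x 2).2.1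
    - minkowski (spinorDot (x 0).2.2 (x 2).2.2) (x 1).2.1
    + minkowski (spinorDot (x 1).2.2 (x 2).2.2) (x 0).2.1
  map_update_add' {inst} v i x y := by
    obtain rfl : inst = instDecidableEqFin 3 := Subsingleton.elim _ _
    fin_cases i <;> simp [Function.update] <;> ring
  map_update_smul' {inst} v i c x := by
    obtain rfl : inst = instDecidableEqFin 3 := Subsingleton.elim _ _
    fin_cases i <;> simp [Function.update] <;> ring

variable (K) in
/-- The superstring Lie 2-superalgebra `𝔰𝔲𝔭𝔢𝔯𝔰𝔱𝔯𝔦𝔫𝔤(n+1, 1)`. -/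
noncomputable def superstring : LInfinityData (Siso K × ℝ) :=
  cocycleExtension (sisoGrading K) (sisoBracket K) (alpha K)

end Superstring

/-! For a spinor `ψ` put `A = ψ · ψ`. Alternativity of the division algebra gives the 3-`ψ` rule
`A ψ = 0`, so `g (ψ · ψ, ψ · ψ)` vanishes on all spinors, and its polarization is the only
component of the cocycle condition for `α` that does not already follow from the invariance of `g`
and of the spinor product under the Lorentz algebra.

`α` is not a coboundary: choose odd `ψ` and `φ` with `A = [ψ, φ]` of length one. Since `[ψ, A]` and
`[φ, A]` vanish, the differential of a 2-cochain `θ` at `(ψ, φ, A)` reduces to `± θ (A, A)`, which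
is zero because `A` is even, whereas `α (ψ, φ, A) = g (A, A) = 1`.

As `d = 0`, only two generalized Jacobi identities of the extension survive: the one in `l₂ ∘ l₂` is
the Jacobi identity of the superalgebra, and the one mixing `l₂` and `l₃` is, after summing over
unshuffles, minus the Chevalley–Eilenberg differential of `α`. -/

/-! ### Signs -/

theorem paritySign_zero : paritySign 0 = 1 := if_pos rfl

theorem paritySign_one : paritySign 1 = -1 := if_neg one_ne_zero

theorem parity_cases (p : ZMod 2) : p = 0 ∨ p = 1 := by
  decide +revert

theorem paritySign_add (p q : ZMod 2) : paritySign (p + q) = paritySign p * paritySign q := by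
  rcases parity_cases p with rfl | rfl <;> rcases parity_cases q with rfl | rfl <;>
    simp [paritySign, CharTwo.add_self_eq_zero]

theorem paritySign_mul_self (p : ZMod 2) : paritySign p * paritySign p = 1 := by
  rw [← paritySign_add, CharTwo.add_self_eq_zero, paritySign_zero]

theorem paritySign_mul_sum {ι : Type*} (s : Finset ι) (q : ZMod 2) (p : ι → ZMod 2) :
    paritySign (q * ∑ k ∈ s, p k) = ∏ k ∈ s, paritySign (q * p k) := by
  classical
  induction s using Finset.induction_on with
  | empty => simp [paritySign_zero]
  | insert k s hk ih =>
    rw [Finset.sum_insert hk, Finset.prod_insert hk, mul_add, paritySign_add, ih]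

theorem chiSign_eq_prod {n : ℕ} (σ : Equiv.Perm (Fin n)) (p : Fin n → ZMod 2) :
    chiSign σ p =
      ∏ u, ∏ v ∈ Finset.Iio u, if σ.symm u < σ.symm v then -paritySign (p u * p v) else 1 := by
  have sign_eq : ((Equiv.Perm.sign σ : ℤ) : ℝ) =
      ∏ u, ∏ v ∈ Finset.Iio u, if σ.symm u < σ.symm v then -1 else 1 := by
    rw [← Equiv.Perm.sign_symm, Equiv.Perm.sign_eq_prod_prod_Iio]
    push_cast
    refine Finset.prod_congr rfl fun u _ => Finset.prod_congr rfl fun v hv => ?_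
    rcases (σ.symm.injective.ne (Finset.mem_Iio.mp hv).ne).lt_or_gt with h | h <;>
      simp [h, h.not_gt]
  have koszul_eq : koszulSign σ p =
      ∏ u, ∏ v ∈ Finset.Iio u, if σ.symm u < σ.symm v then paritySign (p u * p v) else 1 := by
    rw [koszulSign, ← Equiv.prod_comp σ fun u => ∏ v ∈ Finset.Iio u, _]
    refine Finset.prod_congr rfl fun a _ => ?_
    rw [← Finset.filter_gt_eq_Iio, Finset.prod_filter,
      ← Equiv.prod_comp σ fun v => if v < σ a then _ else _]
    simp only [Equiv.symm_apply_apply, ← ite_and, and_comm]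
  rw [chiSign, sign_eq, koszul_eq, ← Finset.prod_mul_distrib]
  refine Finset.prod_congr rfl fun u _ => ?_
  rw [← Finset.prod_mul_distrib]
  exact Finset.prod_congr rfl fun v _ => by split_ifs <;> simp

theorem chiSign_one {n : ℕ} (p : Fin n → ZMod 2) : chiSign 1 p = 1 := by
  rw [chiSign_eq_prod]
  refine Finset.prod_eq_one fun u _ => Finset.prod_eq_one fun v hv => if_neg ?_
  exact (Finset.mem_Iio.mp hv).not_gt

theorem chiSign_swap_fin_two (p : Fin 2 → ZMod 2) :
    chiSign (Equiv.swap 0 1) p = -paritySign (p 0 * p 1) := by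
  rw [chiSign, Equiv.Perm.sign_swap zero_ne_one]
  simp [koszulSign, Fin.prod_univ_two, mul_comm]

/-! ### Unshuffles -/

section SkipTwo

variable {m : ℕ} {i j : Fin (m + 2)}

theorem skipTwo_strictMono (hij : i < j) : StrictMono (skipTwo i j) := by
  intro a b hab
  rw [Fin.lt_def] at hij hab ⊢
  unfold skipTwo
  split_ifs <;> simp only <;> omega

theorem skipTwo_ne_left (hij : i < j) (k : Fin m) : skipTwo i j k ≠ i := by
  rw [Fin.lt_def] at hij
  rw [Ne, Fin.ext_iff]
  unfold skipTwo
  split_ifs <;> simp only <;> omega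

theorem skipTwo_ne_right (hij : i < j) (k : Fin m) : skipTwo i j k ≠ j := by
  rw [Fin.lt_def] at hij
  rw [Ne, Fin.ext_iff]
  unfold skipTwo
  split_ifs <;> simp only <;> omega

theorem range_skipTwo (hij : i < j) : Set.range (skipTwo i j) = {i, j}ᶜ := by
  refine Set.eq_of_subset_of_ncard_le ?_ ?_
  · rintro _ ⟨k, rfl⟩
    simp [skipTwo_ne_left hij, skipTwo_ne_right hij]
  · rw [← Set.image_univ, Set.ncard_image_of_injective _ (skipTwo_strictMono hij).injective,
      Set.ncard_compl, Set.ncard_pair hij.ne]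
    simp

end SkipTwo

namespace IsUnshuffle

variable {m : ℕ} {σ τ : Equiv.Perm (Fin (m + 2))}

theorem zero_lt_one (hσ : IsUnshuffle 2 σ) : σ 0 < σ 1 :=
  hσ 0 1 Fin.zero_lt_one (Or.inl Nat.one_lt_two)

theorem apply_succ_succ (hσ : IsUnshuffle 2 σ) (k : Fin m) :
    σ k.succ.succ = skipTwo (σ 0) (σ 1) k := by
  have strictMono_rest : StrictMono fun k : Fin m => σ k.succ.succ := fun a b hab =>
    hσ _ _ (Fin.succ_lt_succ_iff.mpr (Fin.succ_lt_succ_iff.mpr hab)) (Or.inr (by simp))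
  have range_rest : Set.range (fun k : Fin m => σ k.succ.succ) = {σ 0, σ 1}ᶜ := by
    rw [← Set.image_pair, ← Set.image_compl_eq σ.bijective, ← Function.comp_def, Set.range_comp]
    congr 1
    ext a
    induction a using Fin.cases with
    | zero => simp [Fin.succ_ne_zero]
    | succ a =>
      induction a using Fin.cases with
      | zero => simp [Fin.ext_iff]
      | succ a => simp [Fin.ext_iff]
  exact congrFun ((strictMono_rest.range_inj (skipTwo_strictMono hσ.zero_lt_one)).mp
    (range_rest.trans (range_skipTwo hσ.zero_lt_one).symm)) k

theorem ext (hσ : IsUnshuffle 2 σ) (hτ : IsUnshuffle 2 τ) (h₀ : σ 0 = τ 0) (h₁ : σ 1 = τ 1) :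
    σ = τ := by
  ext1 a
  induction a using Fin.cases with
  | zero => exact h₀
  | succ a =>
    induction a using Fin.cases with
    | zero => exact h₁
    | succ a => rw [hσ.apply_succ_succ, hτ.apply_succ_succ, h₀, h₁]

theorem exists_of_lt {i j : Fin (m + 2)} (hij : i < j) :
    ∃ σ : Equiv.Perm (Fin (m + 2)), IsUnshuffle 2 σ ∧ σ 0 = i ∧ σ 1 = j := by
  let f : Fin (m + 2) → Fin (m + 2) := Fin.cons i (Fin.cons j (skipTwo i j))
  have hf : Function.Injective f := by
    rw [Fin.cons_injective_iff, Fin.cons_injective_iff]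
    refine ⟨?_, ?_, (skipTwo_strictMono hij).injective⟩
    · rw [Fin.range_cons, range_skipTwo hij]
      simp [hij.ne]
    · rw [range_skipTwo hij]
      simp
  refine ⟨Equiv.ofBijective f (Finite.injective_iff_bijective.mp hf), ?_, rfl, rfl⟩
  have exists_eq_succ_succ (a : Fin (m + 2)) (ha : 2 ≤ (a : ℕ)) : ∃ c : Fin m, a = c.succ.succ :=
    ⟨⟨a - 2, by omega⟩, Fin.ext (by simp only [Fin.val_succ]; omega)⟩
  intro a b hab h
  rw [Fin.lt_def] at hab
  rcases h with hb | ha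
  · obtain rfl : a = 0 := Fin.ext (by rw [Fin.val_zero]; omega)
    obtain rfl : b = 1 := Fin.ext (by rw [Fin.val_zero] at hab; rw [Fin.val_one]; omega)
    exact hij
  · obtain ⟨c, rfl⟩ := exists_eq_succ_succ a ha
    obtain ⟨d, rfl⟩ := exists_eq_succ_succ b (ha.trans hab.le)
    exact skipTwo_strictMono hij (Fin.lt_def.mpr (by simpa only [Fin.val_succ,
      Nat.add_lt_add_iff_right] using hab))

theorem symm_lt_symm_iff (hσ : IsUnshuffle 2 σ) {u v : Fin (m + 2)} (hvu : v < u) :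
    σ.symm u < σ.symm v ↔ u = σ 0 ∨ u = σ 1 ∧ v ≠ σ 0 := by
  obtain ⟨a, rfl⟩ := σ.surjective u
  obtain ⟨b, rfl⟩ := σ.surjective v
  simp only [Equiv.symm_apply_apply, EmbeddingLike.apply_eq_iff_eq, ne_eq]
  have hne : a ≠ b := fun h => hvu.ne (congrArg σ h.symm)
  have straddles (hab : a < b) : (a : ℕ) < 2 ∧ 2 ≤ (b : ℕ) := by
    by_contra h
    exact hvu.not_gt (hσ a b hab (by omega))
  simp only [Fin.lt_def, Fin.ext_iff, Fin.val_zero, Fin.val_one, ne_eq] at hne straddles ⊢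
  omega

/-- Moving `X (σ 0)` and `X (σ 1)` to the front produces `frontSign` twice, except that `X (σ 0)`
and `X (σ 1)` are not interchanged. -/
theorem chiSign_eq (hσ : IsUnshuffle 2 σ) (p : Fin (m + 2) → ZMod 2) :
    chiSign σ p = -((-1) ^ ((σ 0 : ℕ) + (σ 1 : ℕ)) * paritySign (p (σ 0) * p (σ 1)) *
      frontSign p (σ 0) * frontSign p (σ 1)) := by
  have hlt := hσ.zero_lt_one
  have factor (u : Fin (m + 2)) :
      (∏ v ∈ Finset.Iio u, if σ.symm u < σ.symm v then -paritySign (p u * p v) else 1) =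
        (if u = σ 0 then ∏ v ∈ Finset.Iio (σ 0), -paritySign (p (σ 0) * p v) else 1) *
        (if u = σ 1 then ∏ v ∈ (Finset.Iio (σ 1)).erase (σ 0), -paritySign (p (σ 1) * p v)
          else 1) := by
    rw [Finset.prod_congr rfl fun v hv => if_congr (hσ.symm_lt_symm_iff (Finset.mem_Iio.mp hv))
      rfl rfl]
    by_cases h₀ : u = σ 0
    · subst h₀
      simp [hlt.ne]
    by_cases h₁ : u = σ 1
    · subst h₁
      simp [h₀, Finset.prod_ite, Finset.filter_ne']
    · simp [h₀, h₁]
  have front (u : Fin (m + 2)) :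
      ∏ v ∈ Finset.Iio u, -paritySign (p u * p v) = (-1) ^ (u : ℕ) * frontSign p u := by
    rw [Finset.prod_neg, Fin.card_Iio, frontSign, paritySign_mul_sum]
  have front_erase : (∏ v ∈ (Finset.Iio (σ 1)).erase (σ 0), -paritySign (p (σ 1) * p v)) =
      -((-1) ^ (σ 1 : ℕ) * paritySign (p (σ 0) * p (σ 1)) * frontSign p (σ 1)) := by
    have h := Finset.mul_prod_erase _ (fun v => -paritySign (p (σ 1) * p v))
      (Finset.mem_Iio.mpr hlt)
    rw [front, mul_comm (p (σ 1))] at h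
    linear_combination (-paritySign (p (σ 0) * p (σ 1))) * h -
      (∏ v ∈ (Finset.Iio (σ 1)).erase (σ 0), -paritySign (p (σ 1) * p v)) *
        paritySign_mul_self (p (σ 0) * p (σ 1))
  simp only [chiSign_eq_prod, factor, Finset.prod_mul_distrib, Finset.prod_ite_eq',
    Finset.mem_univ, if_true, front, front_erase]
  ring

end IsUnshuffle

open Classical in
theorem sum_isUnshuffle_two {m : ℕ} {M : Type*} [AddCommMonoid M]
    (f : Equiv.Perm (Fin (m + 2)) → M) (g : Fin (m + 2) → Fin (m + 2) → M)
    (hfg : ∀ σ, IsUnshuffle 2 σ → f σ = g (σ 0) (σ 1)) :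
    ∑ σ : Equiv.Perm (Fin (m + 2)) with IsUnshuffle 2 σ, f σ =
      ∑ i, ∑ j ∈ Finset.Ioi i, g i j := by
  rw [Finset.sum_sigma']
  refine Finset.sum_bij (fun σ _ => ⟨σ 0, σ 1⟩) ?_ ?_ ?_ ?_
  · intro σ hσ
    simpa using (Finset.mem_filter.mp hσ).2.zero_lt_one
  · intro σ hσ τ hτ h
    rw [Sigma.mk.injEq, heq_eq_eq] at h
    exact (Finset.mem_filter.mp hσ).2.ext (Finset.mem_filter.mp hτ).2 h.1 h.2
  · rintro ⟨i, j⟩ hij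
    obtain ⟨σ, hσ, rfl, rfl⟩ := IsUnshuffle.exists_of_lt (show i < j by simpa using hij)
    exact ⟨σ, Finset.mem_filter.mpr ⟨Finset.mem_univ σ, hσ⟩, rfl⟩
  · exact fun σ hσ => hfg σ (Finset.mem_filter.mp hσ).2

/-! ### The generalized Jacobi identity as a cocycle condition -/

namespace LInfinityData

variable {E : Type*} [AddCommGroup E] [Module ℝ E] {L : LInfinityData E}

/-- Only `l₂` can be the inner bracket of a nonzero term `l_j(l_k(…), …)` of a generalized Jacobi
identity, so that these identities become cocycle conditions for the brackets `l_j`. -/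
def HasOnlyBinaryInnerBrackets (L : LInfinityData E) : Prop :=
  ∀ (k j : ℕ) (v : Fin k → E) (w : Fin j → E), k ≠ 2 → L.l (j + 1) (Fin.cons (L.l k v) w) = 0

theorem jacobiator_eq_neg_ceDifferential (hL : L.HasOnlyBinaryInnerBrackets) {m : ℕ}
    (g : Fin (m + 2) → ℤ × ZMod 2) (x : Fin (m + 2) → E) :
    L.jacobiator g x = -ceDifferential (fun y z => L.l 2 ![y, z]) (fun _ _ => (0 : E)) 0
      (L.l (m + 1)) (fun i => overallGrade (g i)) x := by
  rw [jacobiator, Finset.sum_eq_single ⟨1, by omega⟩]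
  · simp only [Nat.reduceAdd]
    rw [sum_isUnshuffle_two _ fun i j => -(((-1) ^ ((i : ℕ) + (j : ℕ)) *
      paritySign (overallGrade (g i) * overallGrade (g j)) *
      frontSign (fun i => overallGrade (g i)) i * frontSign (fun i => overallGrade (g i)) j) •
        L.l (m + 1) (Fin.cons (L.l 2 ![x i, x j]) fun k => x (skipTwo i j k)))]
    · simp [ceDifferential]
    · intro σ hσ
      have pair : (fun b : Fin 2 => x (σ ⟨b, by omega⟩)) = ![x (σ 0), x (σ 1)] := by
        ext b; fin_cases b <;> rfl
      have rest : (fun c : Fin m => x (σ ⟨2 + c, by omega⟩)) =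
          fun c => x (skipTwo (σ 0) (σ 1) c) := by
        funext c
        rw [← hσ.apply_succ_succ]
        congr 2
        ext
        simp only [Fin.val_succ]
        omega
      change (_ * (-1 : ℝ) ^ (2 * m)) • L.l (m + 1) (Fin.cons (L.l 2 fun b : Fin 2 =>
        x (σ ⟨b, by omega⟩)) fun c : Fin m => x (σ ⟨2 + c, by omega⟩)) = _
      rw [pair, rest, hσ.chiSign_eq, (even_two_mul m).neg_one_pow, mul_one, neg_smul]
  · intro a _ ha
    refine Finset.sum_eq_zero fun σ _ => ?_
    rw [hL _ _ _ _ fun h => ha (Fin.ext (by simpa using h)), smul_zero]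
  · simp

theorem jacobiator_eq_zero_of_lt_two (hL : L.HasOnlyBinaryInnerBrackets) {n : ℕ} (hn : n < 2)
    (g : Fin n → ℤ × ZMod 2) (x : Fin n → E) :
    L.jacobiator g x = 0 := by
  refine Finset.sum_eq_zero fun a _ => Finset.sum_eq_zero fun σ _ => ?_
  rw [hL _ _ _ _ (by omega), smul_zero]

end LInfinityData

/-! ### The Chevalley–Eilenberg differential -/

section TrivialCoefficients

variable {E F : Type*} [AddCommGroup F] [Module ℝ F]

theorem ceDifferential_comp {E' F' : Type*} [AddCommGroup F'] [Module ℝ F'] {m : ℕ}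
    {br : E → E → E} {br' : E' → E' → E'} (π : E' → E) (hπ : ∀ x y, π (br' x y) = br (π x) (π y))
    (f : F →ₗ[ℝ] F') (q : ZMod 2) (ω : (Fin (m + 1) → E) → F) (p : Fin (m + 2) → ZMod 2)
    (X : Fin (m + 2) → E') :
    ceDifferential br' (fun _ _ => (0 : F')) q (fun Y => f (ω fun i => π (Y i))) p X =
      f (ceDifferential br (fun _ _ => (0 : F)) q ω p fun i => π (X i)) := by
  have map_cons (x : E') (Y : Fin m → E') :
      (fun i => π ((Fin.cons x Y : Fin (m + 1) → E') i)) = Fin.cons (π x) fun i => π (Y i) := by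
    funext i
    cases i using Fin.cases <;> rfl
  simp only [ceDifferential, smul_zero, Finset.sum_const_zero, zero_add, map_sum, map_smul,
    map_cons, hπ]

theorem ceDifferential_two (br : E → E → E) (q : ZMod 2) (θ : (Fin 2 → E) → F)
    (p : Fin 3 → ZMod 2) (X : Fin 3 → E) :
    ceDifferential br (fun _ _ => (0 : F)) q θ p X =
      -(θ ![br (X 0) (X 1), X 2] - paritySign (p 1 * p 2) • θ ![br (X 0) (X 2), X 1]
        + (paritySign (p 0 * p 1) * paritySign (p 0 * p 2)) • θ ![br (X 1) (X 2), X 0]) := by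
  have cons_eta (x : E) (Y : Fin 1 → E) : (Fin.cons x Y : Fin 2 → E) = ![x, Y 0] := by
    ext i; fin_cases i <;> rfl
  have s₀₁ := paritySign_mul_self (p 0 * p 1)
  have s₀₂ := paritySign_mul_self (p 0 * p 2)
  have s₁₂ := paritySign_mul_self (p 1 * p 2)
  simp only [ceDifferential, frontSign, cons_eta, Nat.reduceAdd, ← Finset.filter_lt_eq_Ioi,
    ← Finset.filter_gt_eq_Iio, Finset.sum_filter, Fin.sum_univ_three, smul_zero]
  simp only [add_zero, Fin.isValue, lt_self_iff_false, ↓reduceIte, zero_lt_one,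
    Fin.coe_ofNat_eq_mod, Nat.zero_mod, Nat.one_mod, zero_add, pow_one, neg_mul, one_mul,
    not_lt_zero, mul_zero, paritySign_zero, mul_one, Fin.lt_one_iff, Nat.reduceAdd, Fin.reduceEq,
    mul_comm (p 1) (p 0), Nat.succ_eq_add_one, skipTwo, Fin.reduceFinMk, neg_smul,
    Fin.reduceLT, Nat.mod_succ, even_two, Even.neg_pow, one_pow, mul_add, mul_comm (p 2) (p 0),
    mul_comm (p 2) (p 1), paritySign_add, Order.lt_two_iff, Std.le_refl, Fin.mk_one,
    Order.lt_one_iff, Fin.zero_eta, neg_add_rev, neg_sub]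
  match_scalars <;> grind

theorem ceDifferential_three (br : E → E → E) (q : ZMod 2) (ω : (Fin 3 → E) → F)
    (p : Fin 4 → ZMod 2) (X : Fin 4 → E) :
    ceDifferential br (fun _ _ => (0 : F)) q ω p X =
      -(ω ![br (X 0) (X 1), X 2, X 3] - paritySign (p 1 * p 2) • ω ![br (X 0) (X 2), X 1, X 3]
        + (paritySign (p 1 * p 3) * paritySign (p 2 * p 3)) • ω ![br (X 0) (X 3), X 1, X 2]
        + (paritySign (p 0 * p 1) * paritySign (p 0 * p 2)) • ω ![br (X 1) (X 2), X 0, X 3]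
        - (paritySign (p 0 * p 1) * paritySign (p 0 * p 3) * paritySign (p 2 * p 3)) •
            ω ![br (X 1) (X 3), X 0, X 2]
        + (paritySign (p 0 * p 2) * paritySign (p 0 * p 3) * paritySign (p 1 * p 2)
            * paritySign (p 1 * p 3)) • ω ![br (X 2) (X 3), X 0, X 1]) := by
  have cons_eta (x : E) (Y : Fin 2 → E) : (Fin.cons x Y : Fin 3 → E) = ![x, Y 0, Y 1] := by
    ext i; fin_cases i <;> rfl
  have s₀₁ := paritySign_mul_self (p 0 * p 1)
  have s₀₂ := paritySign_mul_self (p 0 * p 2)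
  have s₁₂ := paritySign_mul_self (p 1 * p 2)
  have s₀₃ := paritySign_mul_self (p 0 * p 3)
  have s₁₃ := paritySign_mul_self (p 1 * p 3)
  have s₂₃ := paritySign_mul_self (p 2 * p 3)
  simp only [ceDifferential, frontSign, cons_eta, Nat.reduceAdd, ← Finset.filter_lt_eq_Ioi,
    ← Finset.filter_gt_eq_Iio, Finset.sum_filter, Fin.sum_univ_four, smul_zero]
  simp only [add_zero, Fin.isValue, lt_self_iff_false, ↓reduceIte, zero_lt_one,
    Fin.coe_ofNat_eq_mod, Nat.zero_mod, Nat.one_mod, zero_add, pow_one, neg_mul, one_mul,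
    not_lt_zero, mul_zero, paritySign_zero, mul_one, Fin.lt_one_iff, Nat.reduceAdd, Fin.reduceEq,
    mul_comm (p 1) (p 0), Nat.succ_eq_add_one, skipTwo, Fin.reduceFinMk, Nat.mod_succ,
    Nat.not_ofNat_lt_one, neg_smul, Fin.reduceLT, Nat.reduceMod, even_two, Even.neg_pow, one_pow,
    mul_add, mul_comm (p 2) (p 0), mul_comm (p 2) (p 1), paritySign_add, Order.lt_two_iff,
    Std.le_refl, Fin.mk_one, mul_comm (p 3) (p 0), mul_comm (p 3) (p 1), mul_comm (p 3) (p 2),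
    Nat.one_lt_ofNat, Nat.lt_add_one, Order.lt_one_iff, Fin.zero_eta, zero_le, neg_add_rev, neg_sub]
  match_scalars <;> grind

end TrivialCoefficients

namespace IsLieSuperalgebra

variable {E : Type*} [AddCommGroup E] [Module ℝ E]
  {𝒜 : ZMod 2 → Submodule ℝ E} {br : E →ₗ[ℝ] E →ₗ[ℝ] E}

theorem bracket_comp_perm (h : IsLieSuperalgebra 𝒜 br) (σ : Equiv.Perm (Fin 2))
    {p : Fin 2 → ZMod 2} {x : Fin 2 → E} (hx : ∀ i, x i ∈ 𝒜 (p i)) :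
    br (x (σ 0)) (x (σ 1)) = chiSign σ p • br (x 0) (x 1) := by
  obtain rfl | rfl : σ = 1 ∨ σ = Equiv.swap 0 1 := by decide +revert
  · rw [chiSign_one, one_smul, Equiv.Perm.one_apply, Equiv.Perm.one_apply]
  · rw [chiSign_swap_fin_two, Equiv.swap_apply_left, Equiv.swap_apply_right,
      h.skew (hx 1) (hx 0), neg_smul, mul_comm]

theorem jacobi_cyclic (h : IsLieSuperalgebra 𝒜 br) {p q r : ZMod 2} {x y z : E}
    (hx : x ∈ 𝒜 p) (hy : y ∈ 𝒜 q) (hz : z ∈ 𝒜 r) :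
    br (br x y) z - paritySign (q * r) • br (br x z) y
      + (paritySign (p * q) * paritySign (p * r)) • br (br y z) x = 0 := by
  have s₁ := paritySign_mul_self (p * q)
  have s₂ := paritySign_mul_self (p * r)
  have s₃ := paritySign_mul_self (q * r)
  rw [h.skew (h.bracket_mem hx hz) hy, h.skew (h.bracket_mem hy hz) hx, h.jacobi hx hy z]
  simp only [add_mul, paritySign_add, mul_comm q p, mul_comm r p, mul_comm r q]
  match_scalars <;> grind

theorem ceDifferential_bracket (h : IsLieSuperalgebra 𝒜 br) (q : ZMod 2) {p : Fin 3 → ZMod 2}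
    {X : Fin 3 → E} (hX : ∀ i, X i ∈ 𝒜 (p i)) :
    ceDifferential (fun x y => br x y) (fun _ _ => (0 : E)) q (bilinToMultilinear br) p X = 0 := by
  rw [ceDifferential_two, neg_eq_zero]
  exact h.jacobi_cyclic (hX 0) (hX 1) (hX 2)

end IsLieSuperalgebra

/-! ### Extensions of Lie superalgebras by cocycles -/

section InternalGradings

variable {ι κ R M N : Type*} [DecidableEq ι] [DecidableEq κ] [Ring R] [AddCommGroup M] [Module R M]
  [AddCommGroup N] [Module R N]

theorem isInternal_of_injective {A : ι → Submodule R M} (hA : DirectSum.IsInternal A)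
    {B : κ → Submodule R M} {e : ι → κ} (he : Function.Injective e) (hBe : ∀ i, B (e i) = A i)
    (hB : ∀ k ∉ Set.range e, B k = ⊥) :
    DirectSum.IsInternal B := by
  rw [DirectSum.isInternal_submodule_iff_iSupIndep_and_iSup_eq_top] at hA ⊢
  refine ⟨fun k => ?_, ?_⟩
  · by_cases hk : k ∈ Set.range e
    · obtain ⟨i, rfl⟩ := hk
      rw [hBe]
      refine (hA.1 i).mono_right (iSup₂_le fun k hki => ?_)
      by_cases hk : k ∈ Set.range e
      · obtain ⟨j, rfl⟩ := hk
        rw [hBe]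
        exact le_iSup₂_of_le j (fun h => hki (congrArg e h)) le_rfl
      · exact (hB k hk).trans_le bot_le
    · rw [hB k hk]
      exact disjoint_bot_left
  · rw [← top_le_iff, ← hA.2]
    exact iSup_le fun i => le_iSup_of_le (e i) (hBe i).ge

theorem isInternal_prod {A : ι → Submodule R M} {B : κ → Submodule R N}
    (hA : DirectSum.IsInternal A) (hB : DirectSum.IsInternal B) :
    DirectSum.IsInternal
      (Sum.elim (fun i => (A i).prod (⊥ : Submodule R N))
        fun k => (⊥ : Submodule R M).prod (B k)) := by
  set C := Sum.elim (fun i => (A i).prod (⊥ : Submodule R N))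
    fun k => (⊥ : Submodule R M).prod (B k) with hC
  rw [DirectSum.isInternal_submodule_iff_iSupIndep_and_iSup_eq_top] at hA hB ⊢
  refine ⟨?_, ?_⟩
  · rintro (i | k)
    · have others_le : ⨆ j, ⨆ (_ : j ≠ Sum.inl i), C j ≤ (⨆ j, ⨆ (_ : j ≠ i), A j).prod ⊤ := by
        refine iSup₂_le ?_
        rintro (j | k) hj
        · exact Submodule.prod_mono (le_iSup₂_of_le j (fun h => hj (congrArg _ h)) le_rfl) le_top
        · exact Submodule.prod_mono bot_le le_top
      refine Disjoint.mono_right others_le (disjoint_iff.mpr ?_)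
      rw [hC, Sum.elim_inl, Submodule.prod_inf_prod, (hA.1 i).eq_bot, bot_inf_eq,
        Submodule.prod_bot]
    · have others_le : ⨆ j, ⨆ (_ : j ≠ Sum.inr k), C j ≤
          (⊤ : Submodule R M).prod (⨆ j, ⨆ (_ : j ≠ k), B j) := by
        refine iSup₂_le ?_
        rintro (i | j) hj
        · exact Submodule.prod_mono le_top bot_le
        · exact Submodule.prod_mono le_top (le_iSup₂_of_le j (fun h => hj (congrArg _ h)) le_rfl)
      refine Disjoint.mono_right others_le (disjoint_iff.mpr ?_)
      rw [hC, Sum.elim_inr, Submodule.prod_inf_prod, (hB.1 k).eq_bot, bot_inf_eq,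
        Submodule.prod_bot]
  · simp only [hC, iSup_sum, Sum.elim_inl, Sum.elim_inr, ← Submodule.map_inl, ← Submodule.map_inr,
      ← Submodule.map_iSup, hA.2, hB.2]
    rw [Submodule.map_inl, Submodule.map_inr, Submodule.prod_sup_prod, sup_bot_eq, bot_sup_eq,
      Submodule.prod_top]

end InternalGradings

theorem evenLine_zero : evenLine 0 = ⊤ := if_pos rfl

theorem evenLine_of_ne_zero {p : ZMod 2} (hp : p ≠ 0) : evenLine p = ⊥ := if_neg hp

theorem isInternal_evenLine : DirectSum.IsInternal evenLine := by
  rw [DirectSum.isInternal_submodule_iff_iSupIndep_and_iSup_eq_top]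
  refine ⟨fun p => ?_, top_le_iff.mp (le_iSup_of_le 0 evenLine_zero.ge)⟩
  by_cases hp : p = 0
  · refine disjoint_bot_right.mono_right (iSup₂_le fun q hq => (evenLine_of_ne_zero ?_).le)
    exact hp ▸ hq
  · rw [evenLine_of_ne_zero hp]
    exact disjoint_bot_left

theorem isLieNSuperalgebra_bLine : LInfinityData.IsLieNSuperalgebra 2 bLine where
  left :=
    { isInternal := isInternal_of_injective isInternal_evenLine (e := fun p => (1, p))
        (Prod.mk_right_injective 1) (fun _ => by simp [bLine])
        fun _ hg => if_neg fun h => hg ⟨_, Prod.ext h.symm rfl⟩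
      nonneg := fun _ _ hd => if_neg (by dsimp only; omega)
      l_zero := rfl
      degree := fun _ _ _ _ => zero_mem _
      skew := fun _ _ _ _ _ => (smul_zero _).symm
      jacobi := fun _ _ _ _ =>
        Finset.sum_eq_zero fun _ _ => Finset.sum_eq_zero fun _ _ => smul_zero _ }
  right := fun _ _ hd => if_neg (by dsimp only; omega)

section Extension

variable {E : Type*} [AddCommGroup E] [Module ℝ E]
  {𝒜 : ZMod 2 → Submodule ℝ E} {br : E →ₗ[ℝ] E →ₗ[ℝ] E}

section LieLInfinity

theorem lieLInfinity_l_of_ne {k : ℕ} (hk : k ≠ 2) : (lieLInfinity 𝒜 br).l k = 0 := by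
  match k, hk with
  | 0, _ => rfl
  | 1, _ => rfl
  | _ + 3, _ => rfl

theorem lieLInfinity_grading_zero (p : ZMod 2) : (lieLInfinity 𝒜 br).grading (0, p) = 𝒜 p := by
  simp [lieLInfinity]

theorem lieLInfinity_grading_of_ne {g : ℤ × ZMod 2} (hg : g.1 ≠ 0) :
    (lieLInfinity 𝒜 br).grading g = ⊥ :=
  if_neg hg

theorem mem_of_mem_lieLInfinity_grading {g : ℤ × ZMod 2} {x : E}
    (hx : x ∈ (lieLInfinity 𝒜 br).grading g) : x ∈ 𝒜 (overallGrade g) := by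
  obtain ⟨d, p⟩ := g
  by_cases hd : d = 0
  · subst hd
    rw [lieLInfinity_grading_zero] at hx
    simpa [overallGrade] using hx
  · rw [lieLInfinity_grading_of_ne hd, Submodule.mem_bot] at hx
    exact hx ▸ zero_mem _

theorem hasOnlyBinaryInnerBrackets_lieLInfinity :
    (lieLInfinity 𝒜 br).HasOnlyBinaryInnerBrackets := fun k j v w hk => by
  refine MultilinearMap.map_coord_zero _ 0 ?_
  rw [Fin.cons_zero, lieLInfinity_l_of_ne hk, zero_apply]

namespace IsLieSuperalgebra

theorem isInternal_lieLInfinity_grading (h : IsLieSuperalgebra 𝒜 br) :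
    DirectSum.IsInternal (lieLInfinity 𝒜 br).grading :=
  isInternal_of_injective h.isInternal (e := fun p => (0, p)) (Prod.mk_right_injective 0)
    lieLInfinity_grading_zero
    fun _ hg => lieLInfinity_grading_of_ne fun hd => hg ⟨_, Prod.ext hd.symm rfl⟩

theorem lieLInfinity_degree (h : IsLieSuperalgebra 𝒜 br) {k : ℕ}
    {g : Fin k → ℤ × ZMod 2} {x : Fin k → E}
    (hx : ∀ i, x i ∈ (lieLInfinity 𝒜 br).grading (g i)) :
    (lieLInfinity 𝒜 br).l k x ∈
      (lieLInfinity 𝒜 br).grading ((∑ i, (g i).1) + (k : ℤ) - 2, ∑ i, (g i).2) := by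
  obtain rfl | hk := eq_or_ne k 2
  · by_cases hg : ∀ i, (g i).1 = 0
    · have hx' (i) : x i ∈ 𝒜 (g i).2 := by
        rw [← lieLInfinity_grading_zero (𝒜 := 𝒜) (br := br), ← hg i]
        exact hx i
      simp only [Fin.sum_univ_two, hg]
      exact (lieLInfinity_grading_zero _).ge (h.bracket_mem (hx' 0) (hx' 1))
    · obtain ⟨i, hi⟩ := not_forall.mp hg
      have hxi := hx i
      rw [lieLInfinity_grading_of_ne hi, Submodule.mem_bot] at hxi
      rw [MultilinearMap.map_coord_zero _ i hxi]
      exact zero_mem _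
  · rw [lieLInfinity_l_of_ne hk]
    exact zero_mem _

theorem lieLInfinity_jacobi (h : IsLieSuperalgebra 𝒜 br) {n : ℕ}
    {g : Fin n → ℤ × ZMod 2} {x : Fin n → E}
    (hx : ∀ i, x i ∈ (lieLInfinity 𝒜 br).grading (g i)) :
    (lieLInfinity 𝒜 br).jacobiator g x = 0 := by
  match n with
  | 0 | 1 =>
    exact LInfinityData.jacobiator_eq_zero_of_lt_two hasOnlyBinaryInnerBrackets_lieLInfinity
      (by omega) g x
  | m + 2 =>
    rw [LInfinityData.jacobiator_eq_neg_ceDifferential hasOnlyBinaryInnerBrackets_lieLInfinity,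
      neg_eq_zero]
    obtain rfl | hm := eq_or_ne m 1
    · exact h.ceDifferential_bracket 0 fun i => mem_of_mem_lieLInfinity_grading (hx i)
    · simp [ceDifferential, lieLInfinity_l_of_ne (show m + 1 ≠ 2 by omega)]

theorem isLieNSuperalgebra_lieLInfinity (h : IsLieSuperalgebra 𝒜 br) :
    LInfinityData.IsLieNSuperalgebra 2 (lieLInfinity 𝒜 br) where
  left :=
    { isInternal := h.isInternal_lieLInfinity_grading
      nonneg := fun _ _ hd => lieLInfinity_grading_of_ne hd.ne
      l_zero := rfl
      degree := fun _ _ _ hx => h.lieLInfinity_degree hx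
      skew := fun k σ g x hx => by
        obtain rfl | hk := eq_or_ne k 2
        · exact h.bracket_comp_perm σ fun i => mem_of_mem_lieLInfinity_grading (hx i)
        · simp [lieLInfinity_l_of_ne hk]
      jacobi := fun _ _ _ hx => h.lieLInfinity_jacobi hx }
  right := fun _ _ hd => lieLInfinity_grading_of_ne (by dsimp only; omega)

end IsLieSuperalgebra

end LieLInfinity

section CocycleExtension

variable {ω : MultilinearMap ℝ (fun _ : Fin 3 => E) ℝ}

theorem cocycleExtension_l_of_ne {k : ℕ} (hk : k ≠ 2) (hk' : k ≠ 3) :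
    (cocycleExtension 𝒜 br ω).l k = 0 := by
  match k, hk, hk' with
  | 0, _, _ => rfl
  | 1, _, _ => rfl
  | _ + 4, _, _ => rfl

theorem cocycleExtension_l_two (v : Fin 2 → E × ℝ) :
    (cocycleExtension 𝒜 br ω).l 2 v = (br (v 0).1 (v 1).1, 0) := rfl

theorem cocycleExtension_l_three (v : Fin 3 → E × ℝ) :
    (cocycleExtension 𝒜 br ω).l 3 v = (0, ω fun i => (v i).1) := rfl

theorem fst_cocycleExtension_l_of_ne {k : ℕ} (hk : k ≠ 2) (v : Fin k → E × ℝ) :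
    ((cocycleExtension 𝒜 br ω).l k v).1 = 0 := by
  obtain rfl | hk' := eq_or_ne k 3
  · rfl
  · rw [cocycleExtension_l_of_ne hk hk']
    rfl

theorem cocycleExtension_l_eq_zero {k : ℕ} {v : Fin k → E × ℝ} {i : Fin k} (hi : (v i).1 = 0) :
    (cocycleExtension 𝒜 br ω).l k v = 0 := by
  obtain rfl | hk := eq_or_ne k 2
  · exact congrArg (LinearMap.inl ℝ E ℝ)
      ((bilinToMultilinear br).map_coord_zero (m := fun j => (v j).1) i hi)
  · obtain rfl | hk' := eq_or_ne k 3
    · exact congrArg (LinearMap.inr ℝ E ℝ) (ω.map_coord_zero (m := fun j => (v j).1) i hi)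
    · rw [cocycleExtension_l_of_ne hk hk']
      rfl

theorem cocycleExtension_grading_zero (p : ZMod 2) :
    (cocycleExtension 𝒜 br ω).grading (0, p) = (𝒜 p).prod ⊥ := by
  simp [cocycleExtension]

theorem cocycleExtension_grading_one (p : ZMod 2) :
    (cocycleExtension 𝒜 br ω).grading (1, p) = (⊥ : Submodule ℝ E).prod (evenLine p) := by
  simp [cocycleExtension]

theorem cocycleExtension_grading_of_ne {g : ℤ × ZMod 2} (hg : g.1 ≠ 0) (hg' : g.1 ≠ 1) :
    (cocycleExtension 𝒜 br ω).grading g = ⊥ :=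
  (if_neg hg).trans (if_neg hg')

theorem fst_eq_zero_of_mem_cocycleExtension_grading {g : ℤ × ZMod 2} (hg : g.1 ≠ 0) {x : E × ℝ}
    (hx : x ∈ (cocycleExtension 𝒜 br ω).grading g) : x.1 = 0 := by
  obtain ⟨d, p⟩ := g
  obtain rfl | hd := eq_or_ne d 1
  · rw [cocycleExtension_grading_one] at hx
    exact hx.1
  · rw [cocycleExtension_grading_of_ne hg hd, Submodule.mem_bot] at hx
    exact congrArg Prod.fst hx

theorem fst_mem_of_mem_cocycleExtension_grading {g : ℤ × ZMod 2} {x : E × ℝ}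
    (hx : x ∈ (cocycleExtension 𝒜 br ω).grading g) : x.1 ∈ (lieLInfinity 𝒜 br).grading g := by
  obtain ⟨d, p⟩ := g
  obtain rfl | hd := eq_or_ne d 0
  · rw [cocycleExtension_grading_zero] at hx
    exact (lieLInfinity_grading_zero p).ge hx.1
  · rw [fst_eq_zero_of_mem_cocycleExtension_grading hd hx]
    exact zero_mem _

theorem fst_mem_overallGrade_of_mem_cocycleExtension_grading {g : ℤ × ZMod 2} {x : E × ℝ}
    (hx : x ∈ (cocycleExtension 𝒜 br ω).grading g) : x.1 ∈ 𝒜 (overallGrade g) :=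
  mem_of_mem_lieLInfinity_grading (fst_mem_of_mem_cocycleExtension_grading hx)

theorem isInternal_cocycleExtension_grading (h : DirectSum.IsInternal 𝒜) :
    DirectSum.IsInternal (cocycleExtension 𝒜 br ω).grading := by
  have hprod := isInternal_prod h isInternal_evenLine
  refine isInternal_of_injective hprod (e := Sum.elim (Prod.mk 0) (Prod.mk 1)) ?_ ?_ ?_
  · exact (Prod.mk_right_injective 0).sumElim (Prod.mk_right_injective 1) (by simp)
  · rintro (p | p)
    · exact cocycleExtension_grading_zero p
    · exact cocycleExtension_grading_one p
  · rintro ⟨d, p⟩ hdp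
    refine cocycleExtension_grading_of_ne ?_ ?_
    · rintro rfl
      exact hdp ⟨Sum.inl p, rfl⟩
    · rintro rfl
      exact hdp ⟨Sum.inr p, rfl⟩

theorem hasOnlyBinaryInnerBrackets_cocycleExtension :
    (cocycleExtension 𝒜 br ω).HasOnlyBinaryInnerBrackets := fun _ _ v _ hk =>
  cocycleExtension_l_eq_zero (i := 0) (fst_cocycleExtension_l_of_ne hk v)

namespace IsEvenCocycle

theorem cocycleExtension_degree (h : IsLieSuperalgebra 𝒜 br) (hω : IsEvenCocycle 𝒜 br ω) {k : ℕ}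
    {g : Fin k → ℤ × ZMod 2} {x : Fin k → E × ℝ}
    (hx : ∀ i, x i ∈ (cocycleExtension 𝒜 br ω).grading (g i)) :
    (cocycleExtension 𝒜 br ω).l k x ∈
      (cocycleExtension 𝒜 br ω).grading ((∑ i, (g i).1) + (k : ℤ) - 2, ∑ i, (g i).2) := by
  by_cases hg : ∀ i, (g i).1 = 0
  · have hx' (i) : (x i).1 ∈ 𝒜 (g i).2 := by
      rw [← lieLInfinity_grading_zero (𝒜 := 𝒜) (br := br), ← hg i]
      exact fst_mem_of_mem_cocycleExtension_grading (hx i)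
    simp only [hg, Finset.sum_const_zero]
    obtain rfl | hk := eq_or_ne k 2
    · rw [Fin.sum_univ_two]
      exact (cocycleExtension_grading_zero _).ge ⟨h.bracket_mem (hx' 0) (hx' 1), rfl⟩
    · obtain rfl | hk' := eq_or_ne k 3
      · exact (cocycleExtension_grading_one _).ge
          ⟨rfl, add_zero (∑ i, (g i).2) ▸ hω.1.parity _ _ hx'⟩
      · rw [cocycleExtension_l_of_ne hk hk']
        exact zero_mem _
  · obtain ⟨i, hi⟩ := not_forall.mp hg
    rw [cocycleExtension_l_eq_zero (fst_eq_zero_of_mem_cocycleExtension_grading hi (hx i))]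
    exact zero_mem _

theorem cocycleExtension_skew (h : IsLieSuperalgebra 𝒜 br) (hω : IsEvenCocycle 𝒜 br ω) {k : ℕ}
    (σ : Equiv.Perm (Fin k)) {g : Fin k → ℤ × ZMod 2} {x : Fin k → E × ℝ}
    (hx : ∀ i, x i ∈ (cocycleExtension 𝒜 br ω).grading (g i)) :
    (cocycleExtension 𝒜 br ω).l k (fun i => x (σ i)) =
      chiSign σ (fun i => overallGrade (g i)) • (cocycleExtension 𝒜 br ω).l k x := by
  have hx' i := fst_mem_overallGrade_of_mem_cocycleExtension_grading (hx i)
  obtain rfl | hk := eq_or_ne k 2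
  · rw [cocycleExtension_l_two, cocycleExtension_l_two,
      h.bracket_comp_perm σ (x := fun i => (x i).1) hx', Prod.smul_mk, smul_zero]
  · obtain rfl | hk' := eq_or_ne k 3
    · rw [cocycleExtension_l_three, cocycleExtension_l_three,
        hω.1.skew σ _ (fun i => (x i).1) hx', Prod.smul_mk, smul_zero]
    · simp [cocycleExtension_l_of_ne hk hk']

theorem cocycleExtension_jacobi (h : IsLieSuperalgebra 𝒜 br) (hω : IsEvenCocycle 𝒜 br ω) {n : ℕ}
    {g : Fin n → ℤ × ZMod 2} {x : Fin n → E × ℝ}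
    (hx : ∀ i, x i ∈ (cocycleExtension 𝒜 br ω).grading (g i)) :
    (cocycleExtension 𝒜 br ω).jacobiator g x = 0 := by
  have hx' i := fst_mem_overallGrade_of_mem_cocycleExtension_grading (hx i)
  match n with
  | 0 | 1 =>
    exact LInfinityData.jacobiator_eq_zero_of_lt_two hasOnlyBinaryInnerBrackets_cocycleExtension
      (by omega) g x
  | m + 2 =>
    rw [LInfinityData.jacobiator_eq_neg_ceDifferential hasOnlyBinaryInnerBrackets_cocycleExtension,
      neg_eq_zero]
    obtain rfl | hm := eq_or_ne m 1
    · refine (ceDifferential_comp (br := fun x y => br x y) Prod.fst (fun _ _ => rfl)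
        (LinearMap.inl ℝ E ℝ) 0 (bilinToMultilinear br) _ x).trans ?_
      rw [h.ceDifferential_bracket 0 hx', map_zero]
    · obtain rfl | hm' := eq_or_ne m 2
      · refine (ceDifferential_comp (br := fun x y => br x y) Prod.fst (fun _ _ => rfl)
          (LinearMap.inr ℝ E ℝ) 0 ω _ x).trans ?_
        rw [hω.2 _ _ hx', map_zero]
      · simp [ceDifferential, cocycleExtension_l_of_ne (show m + 1 ≠ 2 by omega)
          (show m + 1 ≠ 3 by omega)]

theorem isLieNSuperalgebra_cocycleExtension (h : IsLieSuperalgebra 𝒜 br)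
    (hω : IsEvenCocycle 𝒜 br ω) :
    LInfinityData.IsLieNSuperalgebra 2 (cocycleExtension 𝒜 br ω) where
  left :=
    { isInternal := isInternal_cocycleExtension_grading h.isInternal
      nonneg := fun _ _ hd => cocycleExtension_grading_of_ne hd.ne (by dsimp only; omega)
      l_zero := rfl
      degree := fun _ _ _ hx => hω.cocycleExtension_degree h hx
      skew := fun _ σ _ _ hx => hω.cocycleExtension_skew h σ hx
      jacobi := fun _ _ _ hx => hω.cocycleExtension_jacobi h hx }
  right := fun _ _ hd =>
    cocycleExtension_grading_of_ne (by dsimp only; omega) (by dsimp only; omega)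

end IsEvenCocycle

theorem isHom_inr_cocycleExtension :
    LInfinityData.IsHom bLine (cocycleExtension 𝒜 br ω) (LinearMap.inr ℝ E ℝ) where
  map_grading := by
    rintro ⟨d, p⟩ x hx
    obtain rfl | hd := eq_or_ne d 1
    · exact (cocycleExtension_grading_one p).ge ⟨rfl, by simpa [bLine] using hx⟩
    · obtain rfl : x = 0 := by simpa [bLine, hd] using hx
      rw [map_zero]
      exact zero_mem _
  map_l k x := by
    cases k with
    | zero => rfl
    | succ k => exact (map_zero _).trans (cocycleExtension_l_eq_zero (i := 0) rfl).symm

theorem isHom_fst_cocycleExtension :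
    LInfinityData.IsHom (cocycleExtension 𝒜 br ω) (lieLInfinity 𝒜 br) (LinearMap.fst ℝ E ℝ) where
  map_grading _ _ hx := fst_mem_of_mem_cocycleExtension_grading hx
  map_l k x := by
    obtain rfl | hk := eq_or_ne k 2
    · rfl
    · rw [LinearMap.fst_apply, fst_cocycleExtension_l_of_ne hk, lieLInfinity_l_of_ne hk]
      rfl

theorem isShortExact_cocycleExtension :
    LInfinityData.IsShortExact bLine (cocycleExtension 𝒜 br ω) (lieLInfinity 𝒜 br)
      (LinearMap.inr ℝ E ℝ) (LinearMap.fst ℝ E ℝ) where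
  isHom_left := isHom_inr_cocycleExtension
  isHom_right := isHom_fst_cocycleExtension
  injective := LinearMap.inr_injective
  exact := LinearMap.exact_iff.mpr (LinearMap.ker_fst ..)
  surjective := LinearMap.fst_surjective

theorem inl_mem_cocycleExtension_grading {p : ZMod 2} {x : E} (hx : x ∈ 𝒜 p) :
    LinearMap.inl ℝ E ℝ x ∈ (cocycleExtension 𝒜 br ω).grading (0, p) :=
  (cocycleExtension_grading_zero p).ge ⟨hx, rfl⟩

theorem IsCochain.snd_comp_inl {m : ℕ} {q : ZMod 2}
    {θ : MultilinearMap ℝ (fun _ : Fin m => E × ℝ) (E × ℝ)}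
    (h : IsCochain (fun p => (cocycleExtension 𝒜 br ω).grading (0, p))
      (fun p => (cocycleExtension 𝒜 br ω).grading (((1 : ℕ) : ℤ), p)) q θ) :
    IsCochain 𝒜 evenLine q ((LinearMap.snd ℝ E ℝ).compMultilinearMap
      (θ.compLinearMap fun _ => LinearMap.inl ℝ E ℝ)) where
  skew σ p X hX := congrArg Prod.snd
    (h.skew σ p (fun i => LinearMap.inl ℝ E ℝ (X i))
      fun i => inl_mem_cocycleExtension_grading (hX i))
  parity p X hX := ((cocycleExtension_grading_one _).le
    (h.parity p (fun i => LinearMap.inl ℝ E ℝ (X i))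
      fun i => inl_mem_cocycleExtension_grading (hX i))).2

theorem snd_ceDifferential_cocycleExtension {m : ℕ} (q : ZMod 2)
    (θ : MultilinearMap ℝ (fun _ : Fin (m + 1) => E × ℝ) (E × ℝ))
    (p : Fin (m + 2) → ZMod 2) (X : Fin (m + 2) → E) :
    (ceDifferential (fun x y => (cocycleExtension 𝒜 br ω).l 2 ![x, y])
      (fun x f => (cocycleExtension 𝒜 br ω).l 2 ![x, f]) q θ p
      (fun i => LinearMap.inl ℝ E ℝ (X i))).2 =
    ceDifferential (fun x y => br x y) (fun _ _ => (0 : ℝ)) q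
      ((LinearMap.snd ℝ E ℝ).compMultilinearMap
        (θ.compLinearMap fun _ => LinearMap.inl ℝ E ℝ)) p X := by
  have inl_cons (x : E) (Y : Fin m → E) :
      (Fin.cons (x, 0) (fun k => LinearMap.inl ℝ E ℝ (Y k)) : Fin (m + 1) → E × ℝ) =
        fun k => LinearMap.inl ℝ E ℝ ((Fin.cons x Y : Fin (m + 1) → E) k) := by
    funext k
    cases k using Fin.cases <;> rfl
  simp only [ceDifferential, Prod.snd_add, Prod.snd_sum, Prod.smul_snd, cocycleExtension_l_two]
  congr 1
  exact Finset.sum_congr rfl fun i _ => Finset.sum_congr rfl fun j _ =>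
    congrArg (_ • ·) (congrArg (fun Y => (θ Y).2) (inl_cons _ _))

theorem isCoboundary_of_isExact_cocycleExtension
    (h : LInfinityData.IsExact 1 (cocycleExtension 𝒜 br ω)) : IsCoboundary 𝒜 br ω := by
  obtain ⟨-, -, θ₀, θ₁, hθ₀, hθ₁, hω⟩ := h
  refine ⟨_, _, hθ₀.snd_comp_inl, hθ₁.snd_comp_inl, fun p X hX => ?_⟩
  rw [← snd_ceDifferential_cocycleExtension (𝒜 := 𝒜) (ω := ω),
    ← snd_ceDifferential_cocycleExtension (𝒜 := 𝒜) (ω := ω), ← Prod.snd_add]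
  exact congrArg Prod.snd (hω p _ fun i => inl_mem_cocycleExtension_grading (hX i))

end CocycleExtension

end Extension

/-! ### Vectors and spinors over a normed division algebra -/

theorem cyclic_sum_eq_zero_of_apply_self_eq_zero {R M P : Type*} [CommRing R] [Invertible (2 : R)]
    [AddCommGroup M] [Module R M] [AddCommGroup P] [Module R P] {T : M →ₗ[R] M →ₗ[R] M →ₗ[R] P}
    (hcomm : ∀ a b, T a b = T b a) (hself : ∀ a, T a a a = 0) (a b c : M) :
    T a b c + T b c a + T c a b = 0 := by
  have polarization : (2 : R) • (T a b c + T b c a + T c a b) =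
      T (a + b + c) (a + b + c) (a + b + c) - T (a + b) (a + b) (a + b)
        - T (b + c) (b + c) (b + c) - T (c + a) (c + a) (c + a)
        + T a a a + T b b b + T c c c := by
    simp only [map_add, LinearMap.add_apply, hcomm b a, hcomm c b, hcomm a c]
    module
  simpa only [hself, sub_self, add_zero, smul_zero, invOf_smul_smul]
    using congrArg (⅟(2 : R) • ·) polarization

namespace NormedDivisionAlgebra

variable {K : Type*} [NormedDivisionAlgebra K]

theorem ip_star_star (a b : K) : ip (star a) (star b) = ip a b := by
  rw [← re_mul_star a b, re_apply, ip_mul_eq_left, mul_one, ip_comm, star_eq_conj a]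

theorem re_star_mul (a b : K) : re (star a * b) = ip a b := by
  rw [← ip_star_star, ← re_mul_star, star_star]

theorem star_mul_mul_add (a c b : K) :
    star a * (c * b) + star c * (a * b) = (2 * ip a c) • b := by
  refine ip_ext fun d => ?_
  rw [map_add, LinearMap.add_apply, ip_mul_eq_left (star a), ip_mul_eq_left (star c),
    ← star_eq_conj, ← star_eq_conj, star_star, star_star, add_comm, ip_comm (c * b), ip_mul_mul,
    map_smul, LinearMap.smul_apply, smul_eq_mul]

theorem mul_star_mul_add (a c b : K) :
    a * (star c * b) + c * (star a * b) = (2 * ip a c) • b := by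
  simpa only [star_star, ip_star_star] using star_mul_mul_add (star a) (star c) b

theorem mul_star_add (a b : K) : a * star b + b * star a = (2 * ip a b) • (1 : K) := by
  simpa only [mul_one] using mul_star_mul_add a b 1

theorem mul_star_mul_self (a b : K) : b * star a * a = normSq a • b := by
  refine ip_ext fun d => ?_
  have h := ip_mul_mul b (star a) d (star a)
  rw [ip_mul_eq_right, ← star_eq_conj, map_smul, LinearMap.smul_apply, smul_eq_mul, ← ip_self,
    ← ip_star_star a a]
  linarith

end NormedDivisionAlgebra

namespace Superstring

open NormedDivisionAlgebra Matrix

variable {K : Type*} [NormedDivisionAlgebra K]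

theorem exists_eq_mkVec (A : Vec K) : ∃ (a d : ℝ) (y : K), A = mkVec a d y := by
  refine ⟨re (A.1 0 0), re (A.1 1 1), A.1 0 1, Vec.ext ?_⟩
  ext i j
  fin_cases i <;> fin_cases j
  · exact eq_re_smul_of_star_eq (A.star_apply 0 0)
  · rfl
  · exact (A.star_apply 0 1).symm
  · exact eq_re_smul_of_star_eq (A.star_apply 1 1)

theorem minkowski_comm (A B : Vec K) : minkowski A B = minkowski B A := by
  rw [minkowski_apply, minkowski_apply, sub_sub, sub_sub, add_comm (A.1 0 0 * _),
    add_comm (A.1 0 1 * _)]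

theorem minkowski_mkVec_mkVec (a d a' d' : ℝ) (y y' : K) :
    minkowski (mkVec a d y) (mkVec a' d' y') = ip y y' - (a * d' + a' * d) / 2 := by
  rw [minkowski_apply]
  simp [mkVec, re_mul_star, re_one, ip_comm y' y]
  ring

theorem gamma_mkVec (a d : ℝ) (y : K) (ψ : Spinor K) :
    gamma (mkVec a d y) ψ = ![a • ψ 0 + y * ψ 1, star y * ψ 0 + d • ψ 1] := by
  change (mkVec a d y).1 *ᵥ ψ = _
  ext i
  fin_cases i <;> simp [mkVec, Matrix.mulVec, dotProduct, Fin.sum_univ_two]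

theorem gammaTilde_mkVec (a d : ℝ) (y : K) :
    gammaTilde (mkVec a d y) = gamma (mkVec (-d) (-a) y) := by
  have traceReversal_mkVec : traceReversal (mkVec a d y).1 = (mkVec (-d) (-a) y).1 := by
    ext i j
    fin_cases i <;> fin_cases j <;> simp [mkVec, traceReversal, Matrix.trace]
  exact LinearMap.ext fun ψ => congrArg (· *ᵥ ψ) traceReversal_mkVec

theorem spinorDot_eq_mkVec (ψ φ : Spinor K) :
    spinorDot ψ φ = mkVec (-(2 * ip (ψ 1) (φ 1))) (-(2 * ip (ψ 0) (φ 0)))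
      (ψ 0 * star (φ 1) + φ 0 * star (ψ 1)) := by
  refine Vec.ext ((spinorDotFun_val ψ φ).trans ?_)
  ext i j
  fin_cases i <;> fin_cases j <;>
    simp [mkVec, traceReversal, Matrix.trace, vecMulVec_apply, mul_star_add (ψ 0) (φ 0),
      mul_star_add (ψ 1) (φ 1), add_comm (_ * star (ψ 0))]

theorem spinorDot_comm (ψ φ : Spinor K) : spinorDot ψ φ = spinorDot φ ψ := by
  rw [spinorDot_eq_mkVec, spinorDot_eq_mkVec, ip_comm, ip_comm (ψ 0), add_comm]

theorem pairing_eq (ψ φ : Spinor K) : pairing ψ φ = ip (ψ 0) (φ 0) + ip (ψ 1) (φ 1) := by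
  simp [pairing, dotProduct, Fin.sum_univ_two, re_star_mul]

variable (K) in
/-- The pairing `Re(ψ†φ)` as a bilinear form. -/
noncomputable def pairingForm : LinearMap.BilinForm ℝ (Spinor K) :=
  ip.compl₁₂ (LinearMap.proj 0) (LinearMap.proj 0)
    + ip.compl₁₂ (LinearMap.proj 1) (LinearMap.proj 1)

theorem pairingForm_apply (ψ φ : Spinor K) : pairingForm K ψ φ = pairing ψ φ :=
  (pairing_eq ψ φ).symm

theorem pairing_comm (ψ φ : Spinor K) : pairing ψ φ = pairing φ ψ := by
  rw [pairing_eq, pairing_eq, ip_comm, ip_comm (ψ 1)]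

theorem minkowski_spinorDot (ψ φ : Spinor K) (A : Vec K) :
    minkowski (spinorDot ψ φ) A = pairing ψ (gamma A φ) := by
  obtain ⟨a, d, y, rfl⟩ := exists_eq_mkVec A
  have h0 : ip (ψ 0 * star (φ 1)) y = ip (ψ 0) (y * φ 1) := by
    rw [ip_mul_eq_right, ← star_eq_conj, star_star]
  have h1 : ip (φ 0 * star (ψ 1)) y = ip (ψ 1) (star y * φ 0) := by
    rw [ip_mul_eq_right, ← star_eq_conj, star_star, ip_comm, ip_mul_eq_left, star_eq_conj]
  simp only [spinorDot_eq_mkVec, minkowski_mkVec_mkVec, pairing_eq, gamma_mkVec, map_add, map_smul,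
    LinearMap.add_apply, cons_val_zero, cons_val_one, smul_eq_mul, h0, h1]
  ring

theorem pairing_gamma (A : Vec K) (ψ φ : Spinor K) :
    pairing ψ (gamma A φ) = pairing (gamma A ψ) φ := by
  rw [← minkowski_spinorDot, spinorDot_comm, minkowski_spinorDot, pairing_comm]

theorem pairing_gammaTilde (A : Vec K) (ψ φ : Spinor K) :
    pairing ψ (gammaTilde A φ) = pairing (gammaTilde A ψ) φ := by
  obtain ⟨a, d, y, rfl⟩ := exists_eq_mkVec A
  rw [gammaTilde_mkVec, pairing_gamma]

theorem gammaTilde_gamma_add (A B : Vec K) (ψ : Spinor K) :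
    gammaTilde A (gamma B ψ) + gammaTilde B (gamma A ψ) = (2 * minkowski A B) • ψ := by
  obtain ⟨a, d, y, rfl⟩ := exists_eq_mkVec A
  obtain ⟨a', d', y', rfl⟩ := exists_eq_mkVec B
  simp only [gammaTilde_mkVec, gamma_mkVec, minkowski_mkVec_mkVec, cons_val_zero, cons_val_one,
    mul_add, mul_smul_comm]
  ext i
  fin_cases i
  · simp only [Fin.zero_eta, Pi.add_apply, Pi.smul_apply, cons_val_zero]
    linear_combination (norm := module) mul_star_mul_add y y' (ψ 0)
  · simp only [Fin.mk_one, Pi.add_apply, Pi.smul_apply, cons_val_one, cons_val_zero]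
    linear_combination (norm := module) star_mul_mul_add y y' (ψ 1)

theorem gamma_gammaTilde_add (A B : Vec K) (ψ : Spinor K) :
    gamma A (gammaTilde B ψ) + gamma B (gammaTilde A ψ) = (2 * minkowski A B) • ψ := by
  obtain ⟨a, d, y, rfl⟩ := exists_eq_mkVec A
  obtain ⟨a', d', y', rfl⟩ := exists_eq_mkVec B
  have h := gammaTilde_gamma_add (mkVec (-d) (-a) y) (mkVec (-d') (-a') y') ψ
  simp only [gammaTilde_mkVec, neg_neg, minkowski_mkVec_mkVec] at h ⊢
  rw [h, add_comm (-d * _), neg_mul_neg, neg_mul_neg, mul_comm d', mul_comm d]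

theorem gamma_spinorDot_self (ψ : Spinor K) : gamma (spinorDot ψ ψ) ψ = 0 := by
  rw [spinorDot_eq_mkVec, gamma_mkVec, ip_self, ip_self]
  ext i
  fin_cases i
  · simp only [Fin.zero_eta, cons_val_zero, add_mul, mul_star_mul_self, Pi.zero_apply]
    module
  · simp only [Fin.mk_one, cons_val_one, cons_val_zero, star_add, star_mul, star_star, add_mul,
      mul_star_mul_self, Pi.zero_apply]
    module

theorem gamma_spinorDot_cyclic (ψ φ χ : Spinor K) :
    gamma (spinorDot ψ φ) χ + gamma (spinorDot φ χ) ψ + gamma (spinorDot χ ψ) φ = 0 :=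
  cyclic_sum_eq_zero_of_apply_self_eq_zero (T := spinorDot.compr₂ gamma)
    (fun a b => congrArg gamma (spinorDot_comm a b)) gamma_spinorDot_self ψ φ χ

theorem minkowski_spinorDot_cyclic (ψ φ χ ξ : Spinor K) :
    minkowski (spinorDot ψ φ) (spinorDot χ ξ) + minkowski (spinorDot φ χ) (spinorDot ψ ξ)
      + minkowski (spinorDot χ ψ) (spinorDot φ ξ) = 0 := by
  have h := congrArg (pairingForm K ξ) (gamma_spinorDot_cyclic ψ φ χ)
  simpa only [map_add, map_zero, pairingForm_apply, ← minkowski_spinorDot, spinorDot_comm ξ,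
    minkowski_comm (spinorDot _ ξ)] using h

end Superstring

/-! ### Spin representations -/

section Spin

open LinearMap (BilinForm)

variable {𝕜 V W ι : Type*} [Field 𝕜] [AddCommGroup V] [Module 𝕜 V] [AddCommGroup W] [Module 𝕜 W]
  [Fintype ι] [DecidableEq ι] {B : BilinForm 𝕜 V}

theorem sum_apply_smul_dualBasis (hB : B.Nondegenerate) (b : Module.Basis ι 𝕜 V) (v : V) :
    ∑ i, B v (b i) • B.dualBasis hB b i = v := by
  simpa only [BilinForm.dualBasis_repr_apply] using (B.dualBasis hB b).sum_repr v

theorem sum_apply_dualBasis_smul (hB : B.Nondegenerate) (hsymm : B.IsSymm)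
    (b : Module.Basis ι 𝕜 V) (v : V) : ∑ i, B v (B.dualBasis hB b i) • b i = v := by
  simpa only [BilinForm.dualBasis_dualBasis hB hsymm]
    using sum_apply_smul_dualBasis hB (B.dualBasis hB b) v

theorem sum_dualBasis_comm (hB : B.Nondegenerate) (hsymm : B.IsSymm) (b : Module.Basis ι 𝕜 V)
    (F : V →ₗ[𝕜] V →ₗ[𝕜] W) :
    ∑ i, F (B.dualBasis hB b i) (b i) = ∑ i, F (b i) (B.dualBasis hB b i) := by
  set b' := B.dualBasis hB b
  have expand (v : V) : v = ∑ j, B v (b j) • b' j := (sum_apply_smul_dualBasis hB b v).symm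
  calc ∑ i, F (b' i) (b i) = ∑ i, ∑ j, B (b i) (b j) • F (b' i) (b' j) :=
        Finset.sum_congr rfl fun i _ => by
          conv_lhs => rw [expand (b i), map_sum]
          simp only [map_smul]
    _ = ∑ j, ∑ i, B (b j) (b i) • F (b' i) (b' j) := by
        rw [Finset.sum_comm]
        simp only [hsymm.eq]
    _ = ∑ j, F (b j) (b' j) :=
        Finset.sum_congr rfl fun j _ => by
          conv_rhs => rw [expand (b j), map_sum, LinearMap.sum_apply]
          simp only [map_smul, LinearMap.smul_apply]

theorem isSkewAdjoint_apply {T : Module.End 𝕜 V} (hT : B.IsSkewAdjoint T) (v w : V) :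
    B (T v) w = -B v (T w) :=
  (hT v w).trans (map_neg (B v) (T w))

theorem sum_apply_dualBasis_of_isSkewAdjoint (hB : B.Nondegenerate) (hsymm : B.IsSymm)
    (b : Module.Basis ι 𝕜 V) (F : V →ₗ[𝕜] V →ₗ[𝕜] W) {T : Module.End 𝕜 V}
    (hT : B.IsSkewAdjoint T) :
    ∑ i, F (b i) (T (B.dualBasis hB b i)) = -∑ i, F (T (b i)) (B.dualBasis hB b i) := by
  set b' := B.dualBasis hB b
  calc ∑ i, F (b i) (T (b' i)) = ∑ i, ∑ j, B (T (b' i)) (b j) • F (b i) (b' j) :=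
        Finset.sum_congr rfl fun i _ => by
          conv_lhs => rw [← sum_apply_smul_dualBasis hB b (T (b' i)), map_sum]
          simp only [map_smul, b']
    _ = -∑ j, ∑ i, B (T (b j)) (b' i) • F (b i) (b' j) := by
        rw [Finset.sum_comm]
        simp only [isSkewAdjoint_apply hT (b' _), neg_smul, Finset.sum_neg_distrib,
          hsymm.eq (b' _)]
    _ = -∑ j, F (T (b j)) (b' j) :=
        congrArg _ <| Finset.sum_congr rfl fun j _ => by
          conv_rhs => rw [← sum_apply_dualBasis_smul hB hsymm b (T (b j)), map_sum,
            LinearMap.sum_apply]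
          simp only [map_smul, LinearMap.smul_apply, b']

variable {S S' : Type*} [AddCommGroup S] [Module 𝕜 S] [AddCommGroup S'] [Module 𝕜 S']

/-- The two halves `γ : V → Hom(S, S')` and `γ' : V → Hom(S', S)` of a `ℤ/2`-graded Clifford module
`S ⊕ S'` of `(V, B)`. -/
structure IsCliffordPair (B : BilinForm 𝕜 V) (γ : V →ₗ[𝕜] S →ₗ[𝕜] S')
    (γ' : V →ₗ[𝕜] S' →ₗ[𝕜] S) : Prop where
  left : ∀ u v s, γ' u (γ v s) + γ' v (γ u s) = (2 * B u v) • s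
  right : ∀ u v s, γ u (γ' v s) + γ v (γ' u s) = (2 * B u v) • s

/-- The action of the product of two vectors on the half `S` of a Clifford module `S ⊕ S'`. -/
def cliffordMul (γ : V →ₗ[𝕜] S →ₗ[𝕜] S') (γ' : V →ₗ[𝕜] S' →ₗ[𝕜] S) :
    V →ₗ[𝕜] V →ₗ[𝕜] Module.End 𝕜 S :=
  (LinearMap.llcomp 𝕜 S S' S).compl₁₂ γ' γ

theorem cliffordMul_apply (γ : V →ₗ[𝕜] S →ₗ[𝕜] S') (γ' : V →ₗ[𝕜] S' →ₗ[𝕜] S) (u v : V) (s : S) :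
    cliffordMul γ γ' u v s = γ' u (γ v s) := rfl

/-- The action `¼ ∑ᵢ T(bᵢ) bⁱ` of an endomorphism `T` of `V` on the half `S` of a Clifford module
`S ⊕ S'`, where `(bⁱ)` is the basis dual to `(bᵢ)`. It is meant for `T` skew. -/
noncomputable def spinEnd (hB : B.Nondegenerate) (b : Module.Basis ι 𝕜 V)
    (γ : V →ₗ[𝕜] S →ₗ[𝕜] S') (γ' : V →ₗ[𝕜] S' →ₗ[𝕜] S) (T : Module.End 𝕜 V) : Module.End 𝕜 S :=
  (1 / 4 : 𝕜) • ∑ i, cliffordMul γ γ' (T (b i)) (B.dualBasis hB b i)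

variable {γ : V →ₗ[𝕜] S →ₗ[𝕜] S'} {γ' : V →ₗ[𝕜] S' →ₗ[𝕜] S}

theorem spinEnd_apply (hB : B.Nondegenerate) (b : Module.Basis ι 𝕜 V) (T : Module.End 𝕜 V) (s : S) :
    spinEnd hB b γ γ' T s =
      (1 / 4 : 𝕜) • ∑ i, cliffordMul γ γ' (T (b i)) (B.dualBasis hB b i) s := by
  simp only [spinEnd, LinearMap.smul_apply, LinearMap.sum_apply]

variable {T : Module.End 𝕜 V}

namespace IsCliffordPair

theorem symm (h : IsCliffordPair B γ γ') : IsCliffordPair B γ' γ := ⟨h.right, h.left⟩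

theorem mul_mul_eq (h : IsCliffordPair B γ γ') (u v w : V) (s : S) :
    γ u (γ' v (γ w s)) = γ w (γ' u (γ v s)) + (2 : 𝕜) • (B w v • γ u s - B w u • γ v s) := by
  have swap_right := congrArg (γ u) (h.left w v s)
  have swap_left := h.right w u (γ v s)
  rw [map_add, map_smul] at swap_right
  linear_combination (norm := module) swap_right - swap_left

variable [NeZero (2 : 𝕜)]

theorem spinEnd_gamma (h : IsCliffordPair B γ γ') (hB : B.Nondegenerate) (hsymm : B.IsSymm)
    (b : Module.Basis ι 𝕜 V) (hT : B.IsSkewAdjoint T) (v : V) (s : S) :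
    spinEnd hB b γ' γ T (γ v s) = γ v (spinEnd hB b γ γ' T s) + γ (T v) s := by
  have contract : ∑ i, B v (B.dualBasis hB b i) • γ (T (b i)) s = γ (T v) s := by
    conv_rhs => rw [← sum_apply_dualBasis_smul hB hsymm b v]
    simp only [map_sum, map_smul, LinearMap.sum_apply, LinearMap.smul_apply]
  have contract_skew : ∑ i, B v (T (b i)) • γ (B.dualBasis hB b i) s = -γ (T v) s := by
    conv_rhs => rw [← sum_apply_smul_dualBasis hB b (T v)]
    simp only [map_sum, map_smul, LinearMap.sum_apply, LinearMap.smul_apply,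
      isSkewAdjoint_apply hT v, neg_smul, Finset.sum_neg_distrib, map_neg, LinearMap.neg_apply,
      neg_neg]
  have four_ne_zero : (4 : 𝕜) ≠ 0 := by
    rw [← two_add_two_eq_four, ← two_mul]
    exact mul_ne_zero two_ne_zero two_ne_zero
  simp only [spinEnd_apply, cliffordMul_apply, h.mul_mul_eq _ _ v, Finset.sum_add_distrib,
    ← Finset.smul_sum, Finset.sum_sub_distrib, contract, contract_skew, map_smul, map_sum]
  rw [smul_add, smul_smul, sub_neg_eq_add, ← two_smul 𝕜 (γ (T v) s), smul_smul, mul_assoc,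
    two_mul (2 : 𝕜), two_add_two_eq_four, one_div_mul_cancel four_ne_zero, one_smul]

theorem spinEnd_cliffordMul (h : IsCliffordPair B γ γ') (hB : B.Nondegenerate) (hsymm : B.IsSymm)
    (b : Module.Basis ι 𝕜 V) (hT : B.IsSkewAdjoint T) (u v : V) (s : S) :
    spinEnd hB b γ γ' T (cliffordMul γ γ' u v s) =
      cliffordMul γ γ' u v (spinEnd hB b γ γ' T s) + cliffordMul γ γ' (T u) v s
        + cliffordMul γ γ' u (T v) s := by
  simp only [cliffordMul_apply]
  rw [h.symm.spinEnd_gamma hB hsymm b hT, h.spinEnd_gamma hB hsymm b hT, map_add]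
  abel

theorem spinEnd_lie (h : IsCliffordPair B γ γ') (hB : B.Nondegenerate) (hsymm : B.IsSymm)
    (b : Module.Basis ι 𝕜 V) (hT : B.IsSkewAdjoint T) (T' : Module.End 𝕜 V) :
    spinEnd hB b γ γ' ⁅T, T'⁆ = ⁅spinEnd hB b γ γ' T, spinEnd hB b γ γ' T'⁆ := by
  refine LinearMap.ext fun s => ?_
  have skew := congrArg (fun f : Module.End 𝕜 S => f s)
    (sum_apply_dualBasis_of_isSkewAdjoint hB hsymm b ((cliffordMul γ γ').comp T') hT)
  simp only [LinearMap.comp_apply, LinearMap.neg_apply, LinearMap.sum_apply] at skew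
  rw [Ring.lie_def (spinEnd hB b γ γ' T), LinearMap.sub_apply, Module.End.mul_apply,
    Module.End.mul_apply, spinEnd_apply hB b T' s, spinEnd_apply hB b T',
    spinEnd_apply hB b ⁅T, T'⁆]
  simp only [map_smul, map_sum, h.spinEnd_cliffordMul hB hsymm b hT, Finset.sum_add_distrib, skew,
    Ring.lie_def, LinearMap.sub_apply, Module.End.mul_apply, map_sub, Finset.sum_sub_distrib]
  module

end IsCliffordPair

theorem pairing_spinEnd_left (hB : B.Nondegenerate) (hsymm : B.IsSymm) (b : Module.Basis ι 𝕜 V)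
    (hT : B.IsSkewAdjoint T) {P : S →ₗ[𝕜] S' →ₗ[𝕜] 𝕜}
    (hγ : ∀ v s t, P s (γ v t) = P t (γ v s))
    (hγ' : ∀ v s' t', P (γ' v s') t' = P (γ' v t') s') (s : S) (s' : S') :
    P (spinEnd hB b γ γ' T s) s' = -P s (spinEnd hB b γ' γ T s') := by
  have transpose (u v : V) : P (cliffordMul γ γ' u v s) s' = P s (cliffordMul γ' γ v u s') := by
    rw [cliffordMul_apply, cliffordMul_apply, hγ', hγ]
  have reverse : ∑ i, cliffordMul γ' γ (B.dualBasis hB b i) (T (b i)) =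
      -∑ i, cliffordMul γ' γ (T (b i)) (B.dualBasis hB b i) := by
    rw [← sum_apply_dualBasis_of_isSkewAdjoint hB hsymm b _ hT]
    exact sum_dualBasis_comm hB hsymm b ((cliffordMul γ' γ).compl₂ T)
  replace reverse := congrArg (fun f : Module.End 𝕜 S' => P s (f s')) reverse
  simp only [LinearMap.sum_apply, LinearMap.neg_apply, map_sum, map_neg] at reverse
  simp only [spinEnd_apply, LinearMap.smul_apply, LinearMap.sum_apply, map_smul, map_sum, transpose,
    reverse, smul_neg]

end Spin

namespace Superstring

variable {K : Type*} [NormedDivisionAlgebra K]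

theorem minkowski_isSymm : (minkowski (K := K)).IsSymm := ⟨minkowski_comm⟩

theorem isCliffordPair_gamma_gammaTilde :
    IsCliffordPair (minkowski (K := K)) gamma gammaTilde :=
  ⟨gammaTilde_gamma_add, gamma_gammaTilde_add⟩

theorem Lorentz.isSkewAdjoint (T : Lorentz K) : (minkowski (K := K)).IsSkewAdjoint T.1 :=
  (LinearMap.mem_skewAdjointSubmodule _).mp T.2

theorem spinAction_eq_spinEnd (T : Lorentz K) :
    spinAction T =
      spinEnd minkowski_nondegenerate (Module.finBasis ℝ (Vec K)) gamma gammaTilde T.1 := by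
  simp only [spinAction, spinEnd, LinearMap.smul_apply, LinearMap.sum_apply]
  rfl

theorem spinAction_lorentzBracket (T T' : Lorentz K) :
    spinAction (lorentzBracket T T') =
      ⁅(spinAction T : Module.End ℝ (Spinor K)), spinAction T'⁆ := by
  simp only [spinAction_eq_spinEnd]
  exact isCliffordPair_gamma_gammaTilde.spinEnd_lie minkowski_nondegenerate minkowski_isSymm _
    T.isSkewAdjoint T'.1

theorem minkowski_spinorDot_spinAction (T : Lorentz K) (ψ φ : Spinor K) (A : Vec K) :
    minkowski (spinorDot (spinAction T ψ) φ) A + minkowski (spinorDot ψ (spinAction T φ)) A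
      + minkowski (spinorDot ψ φ) (T.1 A) = 0 := by
  set T' := spinEnd minkowski_nondegenerate (Module.finBasis ℝ (Vec K)) gammaTilde gamma T.1
  have adjoint : pairing (spinAction T ψ) (gamma A φ) = -pairing ψ (T' (gamma A φ)) := by
    rw [spinAction_eq_spinEnd, ← pairingForm_apply, ← pairingForm_apply]
    refine pairing_spinEnd_left minkowski_nondegenerate minkowski_isSymm _ T.isSkewAdjoint
      (fun A ψ φ => ?_) (fun A ψ φ => ?_) ψ (gamma A φ)
    · rw [pairingForm_apply, pairingForm_apply, pairing_gamma, pairing_comm]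
    · rw [pairingForm_apply, pairingForm_apply, pairing_comm, pairing_gammaTilde]
  have equivariant : T' (gamma A φ) = gamma A (spinAction T φ) + gamma (T.1 A) φ := by
    rw [spinAction_eq_spinEnd]
    exact isCliffordPair_gamma_gammaTilde.spinEnd_gamma minkowski_nondegenerate minkowski_isSymm _
      T.isSkewAdjoint A φ
  rw [minkowski_spinorDot, minkowski_spinorDot, minkowski_spinorDot, adjoint, equivariant,
    ← pairingForm_apply, map_add, pairingForm_apply, pairingForm_apply]
  ring

theorem apply_spinorDot (T : Lorentz K) (ψ φ : Spinor K) :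
    T.1 (spinorDot ψ φ) = spinorDot (spinAction T ψ) φ + spinorDot ψ (spinAction T φ) := by
  refine sub_eq_zero.mp (minkowski_nondegenerate.1 _ fun A => ?_)
  rw [map_sub, LinearMap.sub_apply, map_add, LinearMap.add_apply,
    isSkewAdjoint_apply T.isSkewAdjoint]
  linear_combination -minkowski_spinorDot_spinAction T ψ φ A

end Superstring

section NotCoboundary

variable {E : Type*} [AddCommGroup E] [Module ℝ E] {𝒜 : ZMod 2 → Submodule ℝ E}

theorem IsCochain.apply_self_of_even {F : Type*} [AddCommGroup F] [Module ℝ F]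
    {ℬ : ZMod 2 → Submodule ℝ F} {q : ZMod 2} {θ : MultilinearMap ℝ (fun _ : Fin 2 => E) F}
    (hθ : IsCochain 𝒜 ℬ q θ) {x : E} (hx : x ∈ 𝒜 0) : θ ![x, x] = 0 := by
  have := IsAddTorsionFree.of_isTorsionFree ℝ F
  have h := hθ.skew (Equiv.swap 0 1) (fun _ => 0) (fun _ => x) fun _ => hx
  rw [chiSign_swap_fin_two, mul_zero, paritySign_zero, neg_one_smul, self_eq_neg] at h
  rwa [show ![x, x] = fun _ => x from List.ofFn_injective rfl]

theorem not_isCoboundary_of_apply_ne_zero {br : E →ₗ[ℝ] E →ₗ[ℝ] E}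
    {ω : MultilinearMap ℝ (fun _ : Fin 3 => E) ℝ} {p q : ZMod 2} {x y : E} (hx : x ∈ 𝒜 p)
    (hy : y ∈ 𝒜 q) (hxy : br x y ∈ 𝒜 0) (hx_br : br x (br x y) = 0) (hy_br : br y (br x y) = 0)
    (hω : ω ![x, y, br x y] ≠ 0) : ¬ IsCoboundary 𝒜 br ω := by
  rintro ⟨θ₀, θ₁, hθ₀, hθ₁, h⟩
  have differential_eq_zero {r : ZMod 2} {θ : MultilinearMap ℝ (fun _ : Fin 2 => E) ℝ}
      (hθ : IsCochain 𝒜 evenLine r θ) :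
      ceDifferential (fun x y => br x y) (fun _ _ => (0 : ℝ)) r θ ![p, q, 0] ![x, y, br x y] =
        0 := by
    have zero_left (z : E) : θ ![0, z] = 0 := θ.map_coord_zero 0 rfl
    simp only [ceDifferential_two, Matrix.cons_val_zero, Matrix.cons_val_one, Matrix.cons_val,
      hx_br, hy_br, zero_left, hθ.apply_self_of_even hxy, smul_zero, sub_zero, add_zero, neg_zero]
  refine hω ((h ![p, q, 0] _ ?_).trans ?_)
  · simp only [Fin.forall_fin_succ, Matrix.cons_val_zero, Matrix.cons_val_succ, hx, hy, hxy,
      IsEmpty.forall_iff, and_self]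
  · exact (congrArg₂ (· + ·) (differential_eq_zero hθ₀) (differential_eq_zero hθ₁)).trans
      (add_zero 0)

end NotCoboundary

/-! ### The Poincaré superalgebra and its cocycle -/

namespace Superstring

open NormedDivisionAlgebra

variable {K : Type*} [NormedDivisionAlgebra K]

theorem mem_sisoGrading_zero {x : Siso K} : x ∈ sisoGrading K 0 ↔ x.2.2 = 0 := by
  simp [sisoGrading, Submodule.mem_prod]

theorem mem_sisoGrading_one {x : Siso K} : x ∈ sisoGrading K 1 ↔ x.1 = 0 ∧ x.2.1 = 0 := by
  simp [sisoGrading, Submodule.mem_prod]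

theorem mem_sisoGrading_iff {p : ZMod 2} {x : Siso K} :
    x ∈ sisoGrading K p ↔ p = 0 ∧ x.2.2 = 0 ∨ p = 1 ∧ x.1 = 0 ∧ x.2.1 = 0 := by
  rcases parity_cases p with rfl | rfl
  · simp only [mem_sisoGrading_zero, true_and, zero_ne_one, false_and, or_false]
  · simp only [mem_sisoGrading_one, true_and, one_ne_zero, false_and, false_or]

theorem isInternal_sisoGrading : DirectSum.IsInternal (sisoGrading K) := by
  rw [DirectSum.isInternal_submodule_iff_isCompl (sisoGrading K) (i := 0) (j := 1) zero_ne_one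
    (Set.eq_univ_of_forall parity_cases).symm]
  constructor
  · rw [Submodule.disjoint_def]
    intro x hx₀ hx₁
    rw [mem_sisoGrading_zero] at hx₀
    rw [mem_sisoGrading_one] at hx₁
    exact Prod.ext hx₁.1 (Prod.ext hx₁.2 hx₀)
  · refine Submodule.codisjoint_iff_exists_add_eq.mpr fun x => ⟨(x.1, x.2.1, 0), (0, 0, x.2.2),
      mem_sisoGrading_zero.mpr rfl, mem_sisoGrading_one.mpr ⟨rfl, rfl⟩, ?_⟩
    simp only [Prod.mk_add_mk, add_zero, zero_add]

theorem sisoBracket_apply (x y : Siso K) :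
    sisoBracket K x y = (lorentzBracket x.1 y.1,
      x.1.1 y.2.1 - y.1.1 x.2.1 + spinorDot x.2.2 y.2.2,
      spinAction x.1 y.2.2 - spinAction y.1 x.2.2) := rfl

theorem lorentzBracket_zero_left (T : Lorentz K) : lorentzBracket 0 T = 0 :=
  Subtype.ext (by simp [lorentzBracket, Ring.lie_def])

theorem lorentzBracket_zero_right (T : Lorentz K) : lorentzBracket T 0 = 0 :=
  Subtype.ext (by simp [lorentzBracket, Ring.lie_def])

theorem lorentzBracket_skew (T T' : Lorentz K) : lorentzBracket T T' = -lorentzBracket T' T :=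
  Subtype.ext (neg_sub (T'.1 * T.1) (T.1 * T'.1)).symm

theorem lorentzBracket_jacobi (T T' T'' : Lorentz K) :
    lorentzBracket T (lorentzBracket T' T'') =
      lorentzBracket (lorentzBracket T T') T'' + lorentzBracket T' (lorentzBracket T T'') :=
  Subtype.ext (LieRing.ofAssociativeRing.leibniz_lie T.1 T'.1 T''.1)

theorem lorentzBracket_apply (T T' : Lorentz K) (v : Vec K) :
    (lorentzBracket T T').1 v = T.1 (T'.1 v) - T'.1 (T.1 v) := rfl

theorem spinAction_lorentzBracket_apply (T T' : Lorentz K) (ψ : Spinor K) :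
    spinAction (lorentzBracket T T') ψ =
      spinAction T (spinAction T' ψ) - spinAction T' (spinAction T ψ) := by
  rw [spinAction_lorentzBracket, Ring.lie_def, LinearMap.sub_apply, Module.End.mul_apply,
    Module.End.mul_apply]

theorem sisoBracket_mem_sisoGrading {p q : ZMod 2} {x y : Siso K} (hx : x ∈ sisoGrading K p)
    (hy : y ∈ sisoGrading K q) : sisoBracket K x y ∈ sisoGrading K (p + q) := by
  rw [mem_sisoGrading_iff] at hx hy
  rcases hx with ⟨rfl, hx⟩ | ⟨rfl, hx, hx'⟩ <;> rcases hy with ⟨rfl, hy⟩ | ⟨rfl, hy, hy'⟩ <;>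
    simp [sisoBracket_apply, mem_sisoGrading_zero, mem_sisoGrading_one, CharTwo.add_self_eq_zero,
      lorentzBracket_zero_left, lorentzBracket_zero_right, *]

theorem sisoBracket_skew {p q : ZMod 2} {x y : Siso K} (hx : x ∈ sisoGrading K p)
    (hy : y ∈ sisoGrading K q) :
    sisoBracket K x y = -(paritySign (p * q) • sisoBracket K y x) := by
  rw [mem_sisoGrading_iff] at hx hy
  rcases hx with ⟨rfl, hx⟩ | ⟨rfl, hx, hx'⟩ <;> rcases hy with ⟨rfl, hy⟩ | ⟨rfl, hy, hy'⟩ <;>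
    simp [sisoBracket_apply, paritySign_zero, paritySign_one, lorentzBracket_skew x.1,
      lorentzBracket_zero_left, lorentzBracket_zero_right, spinorDot_comm x.2.2, *]

theorem sisoBracket_jacobi {p q : ZMod 2} {x y : Siso K} (hx : x ∈ sisoGrading K p)
    (hy : y ∈ sisoGrading K q) (z : Siso K) :
    sisoBracket K x (sisoBracket K y z) =
      sisoBracket K (sisoBracket K x y) z
        + paritySign (p * q) • sisoBracket K y (sisoBracket K x z) := by
  rw [mem_sisoGrading_iff] at hx hy
  rcases hx with ⟨rfl, hx⟩ | ⟨rfl, hx, hx'⟩ <;> rcases hy with ⟨rfl, hy⟩ | ⟨rfl, hy, hy'⟩ <;>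
    simp only [sisoBracket_apply, mul_zero, mul_one, paritySign_zero, paritySign_one, one_smul,
      lorentzBracket_zero_left, lorentzBracket_zero_right, map_zero, map_sub, map_neg,
      LinearMap.zero_apply, LinearMap.neg_apply, ZeroMemClass.coe_zero, sub_zero, zero_sub,
      zero_add, add_zero, neg_zero, Prod.mk_add_mk, lorentzBracket_apply,
      spinAction_lorentzBracket_apply, apply_spinorDot, *]
  · refine Prod.ext (lorentzBracket_jacobi _ _ _) (Prod.ext ?_ ?_) <;> dsimp only <;> abel
  · refine Prod.ext rfl (Prod.ext rfl ?_)
    dsimp only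
    abel
  · refine Prod.ext rfl (Prod.ext ?_ ?_) <;> dsimp only
    · rw [spinorDot_comm x.2.2]
      abel
    · abel
  · simp only [Prod.smul_mk, neg_smul, one_smul, Prod.neg_mk, Prod.mk_add_mk, neg_zero, add_zero,
      smul_zero, spinorDot_comm y.2.2]
    refine Prod.ext rfl (Prod.ext ?_ rfl)
    dsimp only
    abel

theorem isLieSuperalgebra_siso : IsLieSuperalgebra (sisoGrading K) (sisoBracket K) where
  isInternal := isInternal_sisoGrading
  bracket_mem := sisoBracket_mem_sisoGrading
  skew := sisoBracket_skew
  jacobi := sisoBracket_jacobi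

theorem alpha_apply (X : Fin 3 → Siso K) :
    alpha K X = minkowski (spinorDot (X 0).2.2 (X 1).2.2) (X 2).2.1
      - minkowski (spinorDot (X 0).2.2 (X 2).2.2) (X 1).2.1
      + minkowski (spinorDot (X 1).2.2 (X 2).2.2) (X 0).2.1 := rfl

theorem alpha_vec (x y z : Siso K) :
    alpha K ![x, y, z] = minkowski (spinorDot x.2.2 y.2.2) z.2.1
      - minkowski (spinorDot x.2.2 z.2.2) y.2.1 + minkowski (spinorDot y.2.2 z.2.2) x.2.1 := rfl

theorem perm_fin_three_eq (σ : Equiv.Perm (Fin 3)) :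
    σ = 1 ∨ σ = Equiv.swap 0 1 ∨ σ = Equiv.swap 1 2 ∨ σ = Equiv.swap 0 2 ∨
      σ = Equiv.swap 0 1 * Equiv.swap 1 2 ∨ σ = Equiv.swap 1 2 * Equiv.swap 0 1 := by
  decide +revert

theorem isCochain_alpha : IsCochain (sisoGrading K) evenLine 0 (alpha K) where
  skew σ p X hX := by
    rw [alpha_apply, alpha_apply, chiSign]
    rcases mem_sisoGrading_iff.mp (hX 0) with ⟨p₀, h₀⟩ | ⟨p₀, -, h₀⟩ <;>
      rcases mem_sisoGrading_iff.mp (hX 1) with ⟨p₁, h₁⟩ | ⟨p₁, -, h₁⟩ <;>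
      rcases mem_sisoGrading_iff.mp (hX 2) with ⟨p₂, h₂⟩ | ⟨p₂, -, h₂⟩ <;>
      rcases perm_fin_three_eq σ with rfl | rfl | rfl | rfl | rfl | rfl <;>
      simp [koszulSign, Fin.prod_univ_three, Equiv.swap_apply_def, Equiv.Perm.sign_swap',
        paritySign_zero, paritySign_one, p₀, p₁, p₂, h₀, h₁, h₂, spinorDot_comm (X 1).2.2,
        spinorDot_comm (X 2).2.2 (X 0).2.2]
  parity p X hX := by
    rw [alpha_apply, add_zero, Fin.sum_univ_three]
    rcases mem_sisoGrading_iff.mp (hX 0) with ⟨p₀, h₀⟩ | ⟨p₀, -, h₀⟩ <;>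
      rcases mem_sisoGrading_iff.mp (hX 1) with ⟨p₁, h₁⟩ | ⟨p₁, -, h₁⟩ <;>
      rcases mem_sisoGrading_iff.mp (hX 2) with ⟨p₂, h₂⟩ | ⟨p₂, -, h₂⟩ <;>
      simp [p₀, p₁, p₂, h₀, h₁, h₂, evenLine_zero, CharTwo.add_self_eq_zero]

theorem isEvenCocycle_alpha : IsEvenCocycle (sisoGrading K) (sisoBracket K) (alpha K) := by
  refine ⟨isCochain_alpha, fun (p : Fin 4 → ZMod 2) (X : Fin 4 → Siso K) hX => ?_⟩
  have invariance (i j k l : Fin 4) :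
      minkowski (spinorDot (spinAction (X i).1 (X k).2.2) (X l).2.2) (X j).2.1
        + minkowski (spinorDot (spinAction (X i).1 (X l).2.2) (X k).2.2) (X j).2.1
        + minkowski (spinorDot (X k).2.2 (X l).2.2) ((X i).1.1 (X j).2.1) = 0 := by
    rw [spinorDot_comm _ (X k).2.2]
    exact minkowski_spinorDot_spinAction _ _ _ _
  refine (ceDifferential_three _ 0 (fun Y : Fin 3 → Siso K => alpha K Y) p X).trans ?_
  simp only [alpha_vec, sisoBracket_apply]
  rcases mem_sisoGrading_iff.mp (hX 0) with ⟨p₀, h₀⟩ | ⟨p₀, h₀, h₀'⟩ <;>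
    rcases mem_sisoGrading_iff.mp (hX 1) with ⟨p₁, h₁⟩ | ⟨p₁, h₁, h₁'⟩ <;>
    rcases mem_sisoGrading_iff.mp (hX 2) with ⟨p₂, h₂⟩ | ⟨p₂, h₂, h₂'⟩ <;>
    rcases mem_sisoGrading_iff.mp (hX 3) with ⟨p₃, h₃⟩ | ⟨p₃, h₃, h₃'⟩ <;>
    simp only [paritySign_zero, paritySign_one, smul_eq_mul, mul_zero, mul_one, one_mul, mul_neg,
      neg_mul, neg_neg, neg_zero, map_zero, map_sub, map_neg, LinearMap.zero_apply,
      LinearMap.neg_apply, ZeroMemClass.coe_zero, add_zero, zero_add, sub_zero, zero_sub, *]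
  · linarith [invariance 0 1 2 3, invariance 1 0 2 3]
  · linarith [invariance 0 2 1 3, invariance 2 0 1 3]
  · linarith [invariance 0 3 1 2, invariance 3 0 1 2]
  · linarith [invariance 1 2 0 3, invariance 2 1 0 3]
  · linarith [invariance 1 3 0 2, invariance 3 1 0 2]
  · linarith [invariance 2 3 0 1, invariance 3 2 0 1]
  · have three_spinors := minkowski_spinorDot_cyclic (X 0).2.2 (X 1).2.2 (X 2).2.2 (X 3).2.2
    rw [spinorDot_comm (X 2).2.2 (X 0).2.2] at three_spinors
    linarith [minkowski_comm (spinorDot (X 0).2.2 (X 1).2.2) (spinorDot (X 2).2.2 (X 3).2.2),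
      minkowski_comm (spinorDot (X 1).2.2 (X 2).2.2) (spinorDot (X 0).2.2 (X 3).2.2),
      minkowski_comm (spinorDot (X 0).2.2 (X 2).2.2) (spinorDot (X 1).2.2 (X 3).2.2)]

variable (K) in
theorem exists_minkowski_spinorDot_self_eq_one :
    ∃ ψ φ : Spinor K, minkowski (spinorDot ψ φ) (spinorDot ψ φ) = 1 :=
  ⟨![1, 0], ![0, 1], by simp [spinorDot_eq_mkVec, minkowski_mkVec_mkVec, ip_self, normSq_one]⟩

theorem not_isCoboundary_alpha : ¬ IsCoboundary (sisoGrading K) (sisoBracket K) (alpha K) := by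
  obtain ⟨ψ, φ, hψφ⟩ := exists_minkowski_spinorDot_self_eq_one K
  have bracket_spinors : sisoBracket K (0, 0, ψ) (0, 0, φ) = (0, spinorDot ψ φ, 0) := by
    simp [sisoBracket_apply, lorentzBracket_zero_left]
  have bracket_vector (χ : Spinor K) : sisoBracket K (0, 0, χ) (0, spinorDot ψ φ, 0) = 0 := by
    simp [sisoBracket_apply, lorentzBracket_zero_left]
  refine not_isCoboundary_of_apply_ne_zero (x := (0, 0, ψ)) (y := (0, 0, φ))
    (mem_sisoGrading_one.mpr ⟨rfl, rfl⟩) (mem_sisoGrading_one.mpr ⟨rfl, rfl⟩) ?_ ?_ ?_ ?_ <;>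
    rw [bracket_spinors]
  · exact mem_sisoGrading_zero.mpr rfl
  · exact bracket_vector ψ
  · exact bracket_vector φ
  · simp [alpha_vec, hψφ]

end Superstring

/-! ### Normed division algebras of dimension 1, 2, 4 and 8 -/

/-- The squared norm of a real inner product space, as a quadratic form. -/
noncomputable def normSqForm (V : Type*) [NormedAddCommGroup V] [InnerProductSpace ℝ V] :
    QuadraticForm ℝ V :=
  LinearMap.BilinMap.toQuadraticMap (innerₗ V)

theorem normSqForm_apply {V : Type*} [NormedAddCommGroup V] [InnerProductSpace ℝ V] (v : V) :
    normSqForm V v = ‖v‖ ^ 2 := by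
  simp [normSqForm]

/-- The normed division algebra structure carried by an associative algebra whose multiplicative
norm comes from an inner product. -/
noncomputable abbrev NormedDivisionAlgebra.ofNormMulClass (A : Type*) [NormedRing A]
    [NormMulClass A] [InnerProductSpace ℝ A] [IsScalarTower ℝ A A] [SMulCommClass ℝ A A]
    [Module.Finite ℝ A] [Nontrivial A] : NormedDivisionAlgebra A where
  normSq := normSqForm A
  normSq_posDef a ha := by
    rw [normSqForm_apply]
    exact pow_pos (norm_pos_iff.2 ha) 2
  normSq_mul a b := by simp only [normSqForm_apply, norm_mul, mul_pow]

/-- The Cayley–Dickson double `K ⊕ K` of a normed division algebra `K`. -/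
def CayleyDickson (K : Type*) : Type _ :=
  K × K

namespace CayleyDickson

@[ext]
theorem ext {K : Type*} {x y : CayleyDickson K} (h₁ : x.1 = y.1) (h₂ : x.2 = y.2) : x = y :=
  Prod.ext h₁ h₂

open NormedDivisionAlgebra

variable {K : Type*} [NormedDivisionAlgebra K]

noncomputable instance : AddCommGroup (CayleyDickson K) := inferInstanceAs (AddCommGroup (K × K))

noncomputable instance : Module ℝ (CayleyDickson K) := inferInstanceAs (Module ℝ (K × K))

instance : Module.Finite ℝ (CayleyDickson K) := inferInstanceAs (Module.Finite ℝ (K × K))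

instance : Nontrivial (CayleyDickson K) := inferInstanceAs (Nontrivial (K × K))

noncomputable instance : Mul (CayleyDickson K) :=
  ⟨fun x y => (x.1 * y.1 - star y.2 * x.2, y.2 * x.1 + x.2 * star y.1)⟩

instance : One (CayleyDickson K) := ⟨((1 : K), (0 : K))⟩

@[simp] theorem zero_fst : (0 : CayleyDickson K).1 = 0 := rfl

@[simp] theorem zero_snd : (0 : CayleyDickson K).2 = 0 := rfl

@[simp] theorem one_fst : (1 : CayleyDickson K).1 = 1 := rfl

@[simp] theorem one_snd : (1 : CayleyDickson K).2 = 0 := rfl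

@[simp] theorem add_fst (x y : CayleyDickson K) : (x + y).1 = x.1 + y.1 := rfl

@[simp] theorem add_snd (x y : CayleyDickson K) : (x + y).2 = x.2 + y.2 := rfl

@[simp] theorem smul_fst (r : ℝ) (x : CayleyDickson K) : (r • x).1 = r • x.1 := rfl

@[simp] theorem smul_snd (r : ℝ) (x : CayleyDickson K) : (r • x).2 = r • x.2 := rfl

@[simp]
theorem mul_fst (x y : CayleyDickson K) : (x * y).1 = x.1 * y.1 - star y.2 * x.2 := rfl

@[simp]
theorem mul_snd (x y : CayleyDickson K) : (x * y).2 = y.2 * x.1 + x.2 * star y.1 := rfl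

noncomputable instance : NonAssocRing (CayleyDickson K) where
  left_distrib x y z := by ext <;> simp [mul_add, add_mul] <;> abel
  right_distrib x y z := by ext <;> simp [mul_add, add_mul] <;> abel
  zero_mul x := by ext <;> simp
  mul_zero x := by ext <;> simp
  one_mul x := by ext <;> simp
  mul_one x := by ext <;> simp

instance : IsScalarTower ℝ (CayleyDickson K) (CayleyDickson K) where
  smul_assoc r x y := by ext <;> simp [smul_mul_assoc, mul_smul_comm, smul_sub]

instance : SMulCommClass ℝ (CayleyDickson K) (CayleyDickson K) where
  smul_comm r x y := by ext <;> simp [smul_mul_assoc, mul_smul_comm, smul_sub]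

/-- The squared norm `|a|² + |b|²` on the Cayley–Dickson double. -/
noncomputable def normSqDouble : QuadraticForm ℝ (CayleyDickson K) :=
  QuadraticMap.prod (normSq (K := K)) (normSq (K := K))

theorem normSqDouble_apply (x : CayleyDickson K) :
    normSqDouble x = normSq x.1 + normSq x.2 := rfl

theorem normSq_star (a : K) : normSq (star a) = normSq a := by
  rw [← ip_self, ip_star_star, ip_self]

theorem normSqDouble_mul (assoc : ∀ a b c : K, a * b * c = a * (b * c)) (x y : CayleyDickson K) :
    normSqDouble (x * y) = normSqDouble x * normSqDouble y := by
  have cross_terms_cancel :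
      ip (x.1 * y.1) (star y.2 * x.2) = ip (y.2 * x.1) (x.2 * star y.1) := by
    rw [ip_mul_eq_right, ip_mul_eq_left, ← star_eq_conj, ← star_eq_conj, assoc]
  simp only [normSqDouble_apply, mul_fst, mul_snd, sub_eq_add_neg, normSq_add, map_neg,
    QuadraticMap.map_neg, normSq_mul, normSq_star, cross_terms_cancel]
  ring

/-- The Cayley–Dickson double of an associative normed division algebra, as a normed division
algebra. -/
noncomputable abbrev normedDivisionAlgebra (assoc : ∀ a b c : K, a * b * c = a * (b * c)) :
    NormedDivisionAlgebra (CayleyDickson K) where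
  normSq := normSqDouble
  normSq_posDef := normSq_posDef.prod normSq_posDef
  normSq_mul := normSqDouble_mul assoc

theorem finrank : Module.finrank ℝ (CayleyDickson K) = 2 * Module.finrank ℝ K := by
  rw [two_mul]
  exact Module.finrank_prod

end CayleyDickson

open scoped Quaternion in
theorem exists_normedDivisionAlgebra {n : ℕ} (hn : n = 1 ∨ n = 2 ∨ n = 4 ∨ n = 8) :
    ∃ (K : Type) (_ : NormedDivisionAlgebra K), Module.finrank ℝ K = n := by
  rcases hn with rfl | rfl | rfl | rfl
  · exact ⟨ℝ, .ofNormMulClass ℝ, Module.finrank_self ℝ⟩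
  · exact ⟨ℂ, .ofNormMulClass ℂ, Complex.finrank_real_complex⟩
  · exact ⟨ℍ[ℝ], .ofNormMulClass ℍ[ℝ], Quaternion.finrank_eq_four⟩
  · let quaternions := NormedDivisionAlgebra.ofNormMulClass ℍ[ℝ]
    refine ⟨CayleyDickson ℍ[ℝ], CayleyDickson.normedDivisionAlgebra mul_assoc, ?_⟩
    rw [CayleyDickson.finrank, Quaternion.finrank_eq_four]

namespace Superstring

open NormedDivisionAlgebra

variable (K : Type*) [NormedDivisionAlgebra K]

/-- The coordinates `(a, d, y)` of a hermitian matrix with diagonal `a`, `d` and upper right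
entry `y`. -/
noncomputable def vecEquiv : Vec K ≃ₗ[ℝ] ℝ × ℝ × K where
  toFun A := (re (A.1 0 0), re (A.1 1 1), A.1 0 1)
  map_add' A B := by simp
  map_smul' c A := by simp
  invFun x := mkVec x.1 x.2.1 x.2.2
  left_inv A := by
    obtain ⟨a, d, y, rfl⟩ := exists_eq_mkVec A
    dsimp only
    congr 1 <;> simp [mkVec, re_one]
  right_inv x := by simp [mkVec, re_one]

theorem finrank_vec : Module.finrank ℝ (Vec K) = Module.finrank ℝ K + 2 := by
  rw [(vecEquiv K).finrank_eq, Module.finrank_prod, Module.finrank_prod, Module.finrank_self]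
  ring

end Superstring

open NormedDivisionAlgebra Superstring LInfinityData in
theorem mainTheorem2 (n : ℕ) (hn : n = 1 ∨ n = 2 ∨ n = 4 ∨ n = 8) :
    (∃ (K : Type) (_ : NormedDivisionAlgebra K), Module.finrank ℝ K = n) ∧
    ∀ (K : Type*) [NormedDivisionAlgebra K], Module.finrank ℝ K = n →
      Module.finrank ℝ (Vec K) = n + 2 ∧
      (∀ (ψ φ : Spinor K) (A : Vec K), minkowski (spinorDot ψ φ) A = pairing ψ (gamma A φ)) ∧
      IsLieSuperalgebra (sisoGrading K) (sisoBracket K) ∧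
      IsEvenCocycle (sisoGrading K) (sisoBracket K) (alpha K) ∧
      ¬ IsCoboundary (sisoGrading K) (sisoBracket K) (alpha K) ∧
      IsLieNSuperalgebra 2 bLine ∧
      IsLieNSuperalgebra 2 (superstring K) ∧
      IsLieNSuperalgebra 2 (lieLInfinity (sisoGrading K) (sisoBracket K)) ∧
      IsShortExact bLine (superstring K) (lieLInfinity (sisoGrading K) (sisoBracket K))
        (LinearMap.inr ℝ (Siso K) ℝ) (LinearMap.fst ℝ (Siso K) ℝ) ∧
      ¬ IsExact 1 (superstring K) := by
  refine ⟨exists_normedDivisionAlgebra hn, fun K _ hK => ⟨?_, minkowski_spinorDot,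
    isLieSuperalgebra_siso, isEvenCocycle_alpha, not_isCoboundary_alpha, isLieNSuperalgebra_bLine,
    isEvenCocycle_alpha.isLieNSuperalgebra_cocycleExtension isLieSuperalgebra_siso,
    isLieSuperalgebra_siso.isLieNSuperalgebra_lieLInfinity, isShortExact_cocycleExtension,
    fun h => not_isCoboundary_alpha (isCoboundary_of_isExact_cocycleExtension h)⟩⟩
  rw [finrank_vec, hK]
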